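/- Let $k,N\ge 2$ be integers, let $B_R\subset\mathbb R^N$ be the open ball of radius $R>0$ centred at $0$, and let $u_1,\dots,u_k\in H^1(B_R)$ satisfy $u_j\ge 0$ a.e. and $\Delta u_j\ge 0$ weakly in $B_R$ (that is, $\int_{B_R}\nabla u_j\cdot\nabla\varphi\,dx\le 0$ for all $0\le\varphi\in C_c^\infty(B_R)$), for $j=1,\dots,k$, and $$\int_{B_R}u_1^2\cdots u_k^2\,dx=0 .$$ For $u\in H^1(\mathbb S^{N-1})$ put $$\lambda(u)=\inf\left\{\frac{\int_{\mathbb S^{N-1}}|\nabla\varphi|^2\,d\sigma}{\int_{\mathbb S^{N-1}}\varphi^2\,d\sigma}\ :\ \varphi\in H^1(\mathbb S^{N-1})\setminus\{0\},\ \mathcal H^{N-1}(\{\varphi\ne0\}\cap\{u=0\})=0\right\}\in[0,+\infty],$$ where $\nabla$ is the tangential gradient, and $\lambda(u)=+\infty$ if $u=0$ a.e. Let $$\gamma(t)=\sqrt{\left(\tfrac{N-2}{2}\right)^2+t}-\tfrac{N-2}{2}\quad(t\ge 0),\qquad \gamma(+\infty)=+\infty,$$ $$\alpha_{k,N}=\inf\left\{\sum_{j=1}^k\gamma(\lambda(v_j))\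 :\ v_1,\dots,v_k\in H^1(\mathbb S^{N-1}),\ \int_{\mathbb S^{N-1}}v_1^2\cdots v_k^2\,d\sigma=0\right\}.$$ Then $\alpha_{k,N}<+\infty$ and, for every $x_0\in B_R$, the integrals $$I(u_j,x_0,r)=\int_{B_r(x_0)}\frac{|\nabla u_j|^2}{|x-x_0|^{N-2}}\,dx$$ are finite for all $j$ and all $0<r<R-|x_0|=\operatorname{dist}(x_0,\partial B_R)$, and the function $$r\mapsto \frac{1}{r^{2\alpha_{k,N}}}\prod_{j=1}^k I(u_j,x_0,r)$$ is monotone non-decreasing on $(0,R-|x_0|)$. -/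

import Mathlib

open MeasureTheory Metric
open scoped RealInnerProductSpace ENNReal ContDiff

namespace ACF

/-- Euclidean space of dimension `N`. -/
abbrev E (N : ℕ) : Type := EuclideanSpace ℝ (Fin N)

/-- The unit sphere in `E N`. -/
abbrev S (N : ℕ) : Type := sphere (0 : E N) 1

/-- Smooth test functions with compact support in the open set `U`. -/
structure IsTest {N : ℕ} (U : Set (E N)) (φ : E N → ℝ) : Prop where
  smooth : ContDiff ℝ ∞ φ
  compact : HasCompactSupport φ
  supp : tsupport φ ⊆ U

/-- `u` belongs to `H¹(U)`, with weak gradient `G` (which is unique up to null sets in `U`). -/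
structure IsH1 {N : ℕ} (U : Set (E N)) (u : E N → ℝ) (G : E N → E N) : Prop where
  memLp : MemLp u 2 (volume.restrict U)
  memLp_grad : MemLp G 2 (volume.restrict U)
  by_parts : ∀ φ : E N → ℝ, IsTest U φ → ∀ v : E N,
    ∫ x in U, u x * fderiv ℝ φ x v = -∫ x in U, φ x * ⟪G x, v⟫

/-- `Δ u ≥ 0` in `U` in the weak sense, for a function with weak gradient `G`:
`∫ ∇u · ∇φ ≤ 0` for every nonnegative test function. -/
def WeaklySubharmonic {N : ℕ} (U : Set (E N)) (G : E N → E N) : Prop :=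
  ∀ φ : E N → ℝ, IsTest U φ → (∀ x, 0 ≤ φ x) → ∫ x in U, ⟪G x, gradient φ x⟫ ≤ 0

/-- The surface measure of the unit sphere. -/
noncomputable def surf (N : ℕ) : Measure (S N) := (volume : Measure (E N)).toSphere

/-- The tangential divergence at `ξ` of a vector field `X` that is tangent to the unit sphere:
the trace of the derivative of `X` minus its normal part. -/
noncomputable def sphereDiv {N : ℕ} (X : E N → E N) (ξ : S N) : ℝ :=
  (∑ i : Fin N, (fderiv ℝ X (ξ : E N) (EuclideanSpace.single i (1 : ℝ))) i)
    - ⟪fderiv ℝ X (ξ : E N) (ξ : E N), (ξ : E N)⟫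

/-- `u` belongs to `H¹` of the unit sphere, with weak tangential gradient `g`:
integration by parts holds against all smooth tangential vector fields. Every smooth
tangential field on the sphere is the restriction of a smooth field `X` on the whole space. -/
structure IsH1Sphere {N : ℕ} (u : S N → ℝ) (g : S N → E N) : Prop where
  memLp : MemLp u 2 (surf N)
  memLp_grad : MemLp g 2 (surf N)
  tangent : ∀ᵐ ξ ∂(surf N), ⟪g ξ, (ξ : E N)⟫ = 0
  by_parts : ∀ X : E N → E N, ContDiff ℝ ∞ X → (∀ ξ : S N, ⟪X ξ, (ξ : E N)⟫ = 0) →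
    ∫ ξ, u ξ * sphereDiv X ξ ∂(surf N) = -∫ ξ, ⟪g ξ, X ξ⟫ ∂(surf N)

/-- The optimal value `λ(u)`: the infimum of the Rayleigh quotients of all nonzero
`φ ∈ H¹` of the sphere that vanish almost everywhere on `{u = 0}`.
It is `⊤` when `u` vanishes almost everywhere, as no `φ` is admissible then. -/
noncomputable def eig {N : ℕ} (u : S N → ℝ) : ℝ≥0∞ :=
  ⨅ (φ : S N → ℝ) (g : S N → E N) (_ : IsH1Sphere φ g)
    (_ : ¬ (∀ᵐ ξ ∂(surf N), φ ξ = 0))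
    (_ : surf N ({ξ | φ ξ ≠ 0} ∩ {ξ | u ξ = 0}) = 0),
    (∫⁻ ξ, ‖g ξ‖ₑ ^ 2 ∂(surf N)) / (∫⁻ ξ, ‖φ ξ‖ₑ ^ 2 ∂(surf N))

/-- `γ(t) = √(((N-2)/2)² + t) - (N-2)/2`. -/
noncomputable def gam (N : ℕ) (t : ℝ) : ℝ :=
  Real.sqrt ((((N : ℝ) - 2) / 2) ^ 2 + t) - ((N : ℝ) - 2) / 2

/-- The extension of `γ` to `[0, ∞]` by `γ(∞) = ∞`. -/
noncomputable def gamExt (N : ℕ) (t : ℝ≥0∞) : ℝ≥0∞ :=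
  if t = ⊤ then ⊤ else ENNReal.ofReal (gam N t.toReal)

/-- The optimal overlapping partition value `α_{k,N}`. -/
noncomputable def alpha (k N : ℕ) : ℝ≥0∞ :=
  ⨅ (u : Fin k → S N → ℝ) (_ : ∀ j, ∃ g : S N → E N, IsH1Sphere (u j) g)
    (_ : ∫⁻ ξ, ENNReal.ofReal (∏ j, u j ξ ^ 2) ∂(surf N) = 0),
    ∑ j, gamExt N (eig (u j))

/-- The integrand `|∇u|² / |x - x₀|^(N-2)`, for a function with weak gradient `G`. -/
noncomputable def dens {N : ℕ} (G : E N → E N) (x₀ x : E N) : ℝ :=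
  ‖G x‖ ^ 2 / ‖x - x₀‖ ^ (N - 2)

/-- `I(u, x₀, r)`, for a function `u` with weak gradient `G`. -/
noncomputable def I {N : ℕ} (G : E N → E N) (x₀ : E N) (r : ℝ) : ℝ :=
  ∫ x in ball x₀ r, dens G x₀ x

/-- `J_ν(u₁, …, u_k, x₀, r)`, for functions `u_j` with weak gradients `G j`. -/
noncomputable def J {k N : ℕ} (ν : ℝ) (G : Fin k → E N → E N) (x₀ : E N) (r : ℝ) : ℝ :=
  1 / r ^ (2 * ν) * ∏ j, I (G j) x₀ r

end ACF

/-!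
The argument is the Alt–Caffarelli–Friedman one, carried out with integrals over spheres.

Translating and cutting off, one may work on the ball of radius `T = R - ‖x₀‖` around the origin
(`isSubharmonicBall_translate`). There `I(u, r) = ∫₀ʳ ρ q(ρ) dρ` in polar coordinates, where
`q(ρ) = ∫ |∇u(ρξ)|² dξ` is the `energy` (`I_eq_integral_energy`).

*Energy bound.* Formally `Δ(u²/2) ≥ |∇u|²`; weakly this is the Caccioppoli inequality
`IsH1.caccioppoli`, obtained by testing subharmonicity with mollifications of `u φ`. Testing it
with the radial weight `|x|^(2-N)`, which is harmonic away from the origin, gives for almost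
every `r` that `I(u, r)` is finite and is at most the `boundaryTerm`
`F(r) = r ∫ u ∂ᵣu + (N-2)/2 ∫ u²`, with integrals over the unit sphere of the functions at
`rξ` (`IsSubharmonicBall.ae_integral_mul_energy_le`). Smooth cut-offs vanishing near the origin
avoid the singularity of the weight: the error terms they produce have a favourable sign, because
the flux through spheres is nonnegative (`flux_nonneg`).

*Spectral bound.* For almost every `r` the slice `ξ ↦ u(rξ)` lies in `H¹` of the sphere and its
tangential gradient is the tangential part of `r ∇u(rξ)` (`ae_isH1Sphere_slice`): vector fields
`ψ(|x|) X(x/|x|)` are used as test fields, for `X` in a countable dense family. A nonzero slice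
competes in the minimization problem that defines its own eigenvalue `λ`. Splitting `∇u` into its
radial and tangential parts and using `γ² + (N-2)γ = λ` for `γ = γ(λ)` gives
`r² q(r) ≥ 2 γ F(r)` (`IsH1Ball.ae_gam_mul_boundaryTerm_le`), hence `r I'(u, r) ≥ 2 γ I(u, r)`.

*Conclusion.* Almost every family of slices is an admissible partition, so that the exponents of
its members add up to at least `α`. Hence the logarithmic derivative of `∏ I(u_j, r)` is at least
`2α / r` wherever the product is positive. As the product is locally absolutely continuous, this
gives the monotonicity (`monotoneOn_rpow_mul_prod`). Finiteness of `α` follows by taking slices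
of smooth functions that are positive exactly on complementary half-spaces (`alpha_ne_top`).
-/

namespace ACF

open Filter Topology Set Convolution

/-! ### Mollification in `L²` -/

/-- The sequence of bump functions at the origin with radii `1 / (n + 1)` and `2 / (n + 1)`. -/
noncomputable def mollifier (V : Type*) [NormedAddCommGroup V] [InnerProductSpace ℝ V] (n : ℕ) :
    ContDiffBump (0 : V) where
  rIn := 1 / ((n : ℝ) + 1)
  rOut := 2 / ((n : ℝ) + 1)
  rIn_pos := by positivity
  rIn_lt_rOut := by gcongr; norm_num

theorem tendsto_mollifier_rOut (V : Type*) [NormedAddCommGroup V] [InnerProductSpace ℝ V] :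
    Tendsto (fun n => (mollifier V n).rOut) atTop (𝓝 0) := by
  have h := (tendsto_one_div_add_atTop_nhds_zero_nat (𝕜 := ℝ)).const_mul 2
  simp only [mul_zero] at h
  refine h.congr fun n => ?_
  simp [mollifier, div_eq_mul_inv]

/-- Correlations of `L²` functions are continuous, because translations act continuously
on `L²`. -/
theorem continuous_integral_mul_translate {N : ℕ} {f g : E N → ℝ} (hf : MemLp f 2)
    (hg : MemLp g 2) : Continuous fun z => ∫ x, g x * f (x + z) := by
  have : Fact ((2 : ℝ≥0∞) ≠ ⊤) := ⟨by norm_num⟩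
  have hc : Continuous fun z : E N =>
      ⟪hg.toLp g, (DomAddAct.mk z) +ᵥ hf.toLp f⟫ := by
    refine continuous_const.inner ?_
    exact (DomAddAct.continuous_mk.vadd continuous_const)
  refine hc.congr fun z => ?_
  rw [DomAddAct.mk_vadd_toLp, L2.inner_def]
  refine integral_congr_ae ?_
  filter_upwards [hg.coeFn_toLp, MemLp.coeFn_toLp (hf.comp_measurePreserving
    (measurePreserving_vadd z (volume : Measure (E N))))] with x h1 h2
  rw [h1]
  refine (congrArg (fun t => ⟪g x, t⟫) h2).trans ?_
  simp [add_comm, mul_comm]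

/-- Mollifications of an `L²` function converge weakly to it: the integral against `g` is a
mollification, evaluated at the origin, of the correlation of the two functions, which is
continuous. -/
theorem tendsto_integral_mul_convolution {N : ℕ} {f g : E N → ℝ} (hf : MemLp f 2)
    (hg : MemLp g 2) :
    Tendsto (fun n => ∫ x, g x *
      ((mollifier (E N) n).normed volume ⋆[ContinuousLinearMap.lsmul ℝ ℝ] f) x) atTop
      (𝓝 (∫ x, g x * f x)) := by
  set K : E N → ℝ := fun z => ∫ x, g x * f (x + z) with hK
  have hKc : Continuous K := continuous_integral_mul_translate hf hg
  have h := ContDiffBump.convolution_tendsto_right_of_continuous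
    (μ := (volume : Measure (E N))) (tendsto_mollifier_rOut (E N)) hKc 0
  have hK0 : K 0 = ∫ x, g x * f x := by simp [hK]
  rw [hK0] at h
  refine h.congr fun n => ?_
  set ρ := (mollifier (E N) n).normed (volume : Measure (E N)) with hρ
  have hρc : Continuous ρ := (mollifier (E N) n).continuous_normed
  have hρs : HasCompactSupport ρ := (mollifier (E N) n).hasCompactSupport_normed
  have hmeas : AEStronglyMeasurable (fun p : E N × E N => g p.1 * (ρ p.2 * f (p.1 - p.2)))
      ((volume : Measure (E N)).prod volume) :=
    (hg.1.comp_fst).mul (hρc.aestronglyMeasurable.convolution_integrand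
      (ContinuousLinearMap.mul ℝ ℝ) hf.1)
  have hint : Integrable (fun p : E N × E N => g p.1 * (ρ p.2 * f (p.1 - p.2)))
      ((volume : Measure (E N)).prod volume) := by
    rw [integrable_prod_iff' hmeas]
    constructor
    · refine Eventually.of_forall fun t => ?_
      have h1 : MemLp (fun x => f (x - t)) 2 :=
        hf.comp_measurePreserving (measurePreserving_sub_right volume t)
      refine ((hg.integrable_mul h1).const_mul (ρ t)).congr (Eventually.of_forall fun x => ?_)
      simp only [Pi.mul_apply]; ring
    · have h2 : Continuous fun t : E N => |ρ t| * ∫ x, |g x| * |f (x + -t)| :=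
        hρc.abs.mul ((continuous_integral_mul_translate hf.abs hg.abs).comp continuous_neg)
      have h3 : HasCompactSupport fun t : E N => |ρ t| * ∫ x, |g x| * |f (x + -t)| :=
        (hρs.comp_left (g := fun x => |x|) abs_zero).mul_right
      refine (h2.integrable_of_hasCompactSupport h3).congr (Eventually.of_forall fun t => ?_)
      simp only
      rw [← integral_const_mul]
      refine integral_congr_ae (Eventually.of_forall fun x => ?_)
      simp only [norm_mul, Real.norm_eq_abs, sub_eq_add_neg]; ring
  have hlhs : (ρ ⋆[ContinuousLinearMap.lsmul ℝ ℝ] K) 0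
      = ∫ t, ∫ x, g x * (ρ t * f (x - t)) := by
    rw [convolution_def]
    refine integral_congr_ae (Eventually.of_forall fun t => ?_)
    simp only [ContinuousLinearMap.lsmul_apply, smul_eq_mul, hK, zero_sub]
    rw [← integral_const_mul]
    refine integral_congr_ae (Eventually.of_forall fun x => ?_)
    simp only [sub_eq_add_neg]; ring
  rw [hlhs, ← integral_integral_swap hint]
  refine integral_congr_ae (Eventually.of_forall fun x => ?_)
  simp only [convolution_def, ContinuousLinearMap.lsmul_apply, smul_eq_mul]
  rw [← integral_const_mul]

/-! ### Caccioppoli inequality and integration by parts for `u²` -/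

section Basic

variable {N : ℕ} {U : Set (E N)} {u : E N → ℝ} {G : E N → E N} {φ θ : E N → ℝ}

theorem IsTest.mul_smooth (hφ : IsTest U φ) (hθ : ContDiff ℝ ∞ θ) :
    IsTest U (fun x => φ x * θ x) where
  smooth := hφ.smooth.mul hθ
  compact := hφ.compact.mul_right
  supp := (tsupport_mul_subset_left).trans hφ.supp

theorem IsTest.continuous_fderiv (hφ : IsTest U φ) (v : E N) :
    Continuous fun x => fderiv ℝ φ x v :=
  (hφ.smooth.continuous_fderiv (by simp)).clm_apply continuous_const

theorem IsTest.hasCompactSupport_fderiv (hφ : IsTest U φ) (v : E N) :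
    HasCompactSupport fun x => fderiv ℝ φ x v :=
  hφ.compact.fderiv_apply ℝ v

theorem IsTest.eq_zero (hφ : IsTest U φ) {x : E N} (hx : x ∉ U) : φ x = 0 :=
  image_eq_zero_of_notMem_tsupport fun h => hx (hφ.supp h)

theorem IsTest.fderiv_eq_zero (hφ : IsTest U φ) {x : E N} (hx : x ∉ U) : fderiv ℝ φ x = 0 :=
  image_eq_zero_of_notMem_tsupport fun h => hx (hφ.supp (tsupport_fderiv_subset ℝ h))

theorem integrable_mul_of_continuous {μ : Measure (E N)} [IsFiniteMeasureOnCompacts μ]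
    {f c : E N → ℝ} (hf : MemLp f 2 μ) (hc : Continuous c) (hs : HasCompactSupport c) :
    Integrable (fun x => f x * c x) μ :=
  hf.integrable_mul (q := 2) (hc.memLp_of_hasCompactSupport hs)

theorem memLp_mul_of_continuous {μ : Measure (E N)} {f c : E N → ℝ} (hf : MemLp f 2 μ)
    (hc : Continuous c) (hs : HasCompactSupport c) : MemLp (fun x => f x * c x) 2 μ := by
  obtain ⟨C, hC⟩ := hs.exists_bound_of_continuous hc
  refine hf.of_le_mul (c := C) (hf.1.mul hc.aestronglyMeasurable)
    (Eventually.of_forall fun x => ?_)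
  rw [norm_mul, mul_comm]
  gcongr
  exact hC x

theorem memLp_of_restrict_of_eq_zero {F : Type*} [NormedAddCommGroup F] {f : E N → F}
    (hU : MeasurableSet U) (hf : MemLp f 2 (volume.restrict U)) (h0 : ∀ x ∉ U, f x = 0) :
    MemLp f 2 := by
  have h : U.indicator f = f := by
    ext1 x
    by_cases hx : x ∈ U
    · simp [hx]
    · simp [hx, h0 x hx]
  rw [← h]
  exact (memLp_indicator_iff_restrict hU).2 hf

theorem IsH1.memLp_inner (hu : IsH1 U u G) (v : E N) :
    MemLp (fun x => ⟪G x, v⟫) 2 (volume.restrict U) :=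
  hu.memLp_grad.inner_const v

/-- The product of an `H¹` function and a test function has a weak derivative on the
whole space, given by the product rule. -/
theorem IsH1.mul_test_by_parts (hu : IsH1 U u G) (hφ : IsTest U φ)
    (hθ : ContDiff ℝ ∞ θ) (v : E N) :
    ∫ x, (u x * φ x) * fderiv ℝ θ x v
      = -∫ x, θ x * (⟪G x, v⟫ * φ x + u x * fderiv ℝ φ x v) := by
  have h := hu.by_parts _ (hφ.mul_smooth hθ) v
  have hd : ∀ x, fderiv ℝ (fun y => φ y * θ y) x v
      = φ x * fderiv ℝ θ x v + θ x * fderiv ℝ φ x v := by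
    intro x
    rw [fderiv_fun_mul (hφ.smooth.differentiable (by simp) x)
      (hθ.differentiable (by simp) x)]
    simp
  have hθ' : Continuous fun x => fderiv ℝ θ x v :=
    (hθ.continuous_fderiv (by simp)).clm_apply continuous_const
  have i1 : Integrable (fun x => u x * (φ x * fderiv ℝ θ x v)) (volume.restrict U) :=
    integrable_mul_of_continuous hu.memLp (hφ.smooth.continuous.mul hθ') hφ.compact.mul_right
  have i2 : Integrable (fun x => u x * (θ x * fderiv ℝ φ x v)) (volume.restrict U) :=
    integrable_mul_of_continuous hu.memLp (hθ.continuous.mul (hφ.continuous_fderiv v))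
      (hφ.hasCompactSupport_fderiv v).mul_left
  have i3 : Integrable (fun x => ⟪G x, v⟫ * (φ x * θ x)) (volume.restrict U) :=
    integrable_mul_of_continuous (hu.memLp_inner v) (hφ.smooth.continuous.mul hθ.continuous)
      hφ.compact.mul_right
  simp_rw [hd, mul_add] at h
  rw [integral_add i1 i2] at h
  rw [← setIntegral_eq_integral_of_forall_compl_eq_zero (s := U)
      (f := fun x => (u x * φ x) * fderiv ℝ θ x v) (fun x hx => by simp [hφ.eq_zero hx]),
    ← setIntegral_eq_integral_of_forall_compl_eq_zero (s := U)
      (f := fun x => θ x * (⟪G x, v⟫ * φ x + u x * fderiv ℝ φ x v))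
      (fun x hx => by simp [hφ.eq_zero hx, hφ.fderiv_eq_zero hx])]
  have e1 : ∫ x in U, θ x * (⟪G x, v⟫ * φ x + u x * fderiv ℝ φ x v)
      = (∫ x in U, ⟪G x, v⟫ * (φ x * θ x)) + ∫ x in U, u x * (θ x * fderiv ℝ φ x v) := by
    rw [← integral_add i3 i2]
    refine integral_congr_ae (Eventually.of_forall fun x => ?_)
    simp only; ring
  have e2 : ∫ x in U, (φ x * θ x) * ⟪G x, v⟫ = ∫ x in U, ⟪G x, v⟫ * (φ x * θ x) := by
    simp_rw [mul_comm]
  have e3 : ∫ x in U, (u x * φ x) * fderiv ℝ θ x v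
      = ∫ x in U, u x * (φ x * fderiv ℝ θ x v) := by simp_rw [mul_assoc]
  rw [e1, e3]
  linarith

/-- The product of an `H¹` function and a test function is a weak limit in `H¹` of test
functions, which are nonnegative if both factors are. -/
theorem IsH1.exists_test_approx (hU : IsOpen U) (hu : IsH1 U u G) (hφ : IsTest U φ) :
    ∃ Φ : ℕ → E N → ℝ, (∀ n, IsTest U (Φ n)) ∧
      ((∀ᵐ x ∂(volume.restrict U), 0 ≤ u x) → (∀ x, 0 ≤ φ x) → ∀ n x, 0 ≤ Φ n x) ∧
      (∀ g, MemLp g 2 (volume.restrict U) →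
        Tendsto (fun n => ∫ x in U, g x * Φ n x) atTop (𝓝 (∫ x in U, g x * (u x * φ x)))) ∧
      (∀ g v, MemLp g 2 (volume.restrict U) →
        Tendsto (fun n => ∫ x in U, g x * fderiv ℝ (Φ n) x v) atTop
          (𝓝 (∫ x in U, g x * (⟪G x, v⟫ * φ x + u x * fderiv ℝ φ x v)))) := by
  set w : E N → ℝ := fun x => u x * φ x with hw
  have hw2 : MemLp w 2 := memLp_of_restrict_of_eq_zero hU.measurableSet
    (memLp_mul_of_continuous hu.memLp hφ.smooth.continuous hφ.compact)
    (fun x hx => by simp [hw, hφ.eq_zero hx])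
  set H : E N → E N → ℝ := fun v x => ⟪G x, v⟫ * φ x + u x * fderiv ℝ φ x v with hH
  have hH2 : ∀ v, MemLp (H v) 2 := fun v => memLp_of_restrict_of_eq_zero hU.measurableSet
    ((memLp_mul_of_continuous (hu.memLp_inner v) hφ.smooth.continuous hφ.compact).add
      (memLp_mul_of_continuous hu.memLp (hφ.continuous_fderiv v)
        (hφ.hasCompactSupport_fderiv v)))
    (fun x hx => by simp [hH, hφ.eq_zero hx, hφ.fderiv_eq_zero hx])
  set L : ℝ →L[ℝ] ℝ →L[ℝ] ℝ := ContinuousLinearMap.lsmul ℝ ℝ with hL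
  set ρ : ℕ → E N → ℝ := fun n => (mollifier (E N) n).normed volume with hρ
  have hwl : LocallyIntegrable w := hw2.locallyIntegrable (by norm_num)
  have hρc : ∀ n, ContDiff ℝ ∞ (ρ n) := fun n => (mollifier (E N) n).contDiff_normed
  have hρs : ∀ n, HasCompactSupport (ρ n) := fun n => (mollifier (E N) n).hasCompactSupport_normed
  have hsm : ∀ n, ContDiff ℝ ∞ (ρ n ⋆[L] w) := fun n =>
    (hρs n).contDiff_convolution_left L (hρc n) hwl
  have hws : tsupport w ⊆ tsupport φ := tsupport_mul_subset_right
  -- the mollification moves the support by at most the radius of the bump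
  obtain ⟨δ, hδ, hδU⟩ := hφ.compact.isCompact.exists_cthickening_subset_open hU hφ.supp
  have hsupp : ∀ n, (mollifier (E N) n).rOut ≤ δ → tsupport (ρ n ⋆[L] w) ⊆ U := by
    intro n hn
    refine (closure_minimal ?_ isClosed_cthickening).trans hδU
    refine (support_convolution_subset L).trans ?_
    rintro _ ⟨a, ha, b, hb, rfl⟩
    rw [(mollifier (E N) n).support_normed_eq] at ha
    refine mem_cthickening_of_dist_le _ b _ _ (hws (subset_closure hb)) ?_
    simp only [mem_ball, dist_zero_right] at ha
    simpa using ha.le.trans hn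
  obtain ⟨n₀, hn₀⟩ := (((tendsto_mollifier_rOut (E N)).eventually
    (Iic_mem_nhds hδ))).exists_forall_of_atTop
  -- the derivative falls on the mollifier and is moved to `w` by the weak product rule
  have hder : ∀ n v x, fderiv ℝ (ρ n ⋆[L] w) x v = (ρ n ⋆[L] H v) x := by
    intro n v x
    have h1 := (hρs n).hasFDerivAt_convolution_left L ((hρc n).of_le (by simp)) hwl x
    rw [h1.fderiv, convolution_eq_swap]
    have hce : ConvolutionExistsAt (fderiv ℝ (ρ n)) w x (L.precompL (E N)) volume :=
      ((hρs n).fderiv ℝ).convolutionExists_left _ ((hρc n).continuous_fderiv (by simp)) hwl x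
    have hi := hce.integrable_swap
    refine (ContinuousLinearMap.integral_apply hi v).trans ?_
    set θ : E N → ℝ := fun y => ρ n (x - y) with hθ
    have hθc : ContDiff ℝ ∞ θ := (hρc n).comp (contDiff_const.sub contDiff_id)
    have hθd : ∀ y, fderiv ℝ θ y v = -(fderiv ℝ (ρ n) (x - y) v) := by
      intro y
      have h2 : HasFDerivAt θ ((fderiv ℝ (ρ n) (x - y)).comp (-ContinuousLinearMap.id ℝ (E N))) y :=
        (((hρc n).differentiable (by simp) (x - y)).hasFDerivAt).comp y
          ((hasFDerivAt_id y).const_sub x)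
      rw [h2.fderiv]; simp
    have h3 := hu.mul_test_by_parts hφ hθc v
    simp_rw [hθd, mul_neg, integral_neg, neg_inj] at h3
    rw [convolution_eq_swap]
    refine Eq.trans ?_ (h3.trans ?_)
    · refine integral_congr_ae (Eventually.of_forall fun y => ?_)
      simp [hL, hw, mul_comm]
    · rfl
  have hind : ∀ g : E N → ℝ, MemLp g 2 (volume.restrict U) → MemLp (U.indicator g) 2 :=
    fun g hg => (memLp_indicator_iff_restrict hU.measurableSet).2 hg
  have hset : ∀ g h : E N → ℝ, ∫ x, U.indicator g x * h x = ∫ x in U, g x * h x := by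
    intro g h
    rw [← integral_indicator hU.measurableSet]
    refine integral_congr_ae (Eventually.of_forall fun x => ?_)
    by_cases hx : x ∈ U <;> simp [hx]
  refine ⟨fun n => ρ (n + n₀) ⋆[L] w, fun n => ⟨hsm _, ?_, hsupp _ (hn₀ _ (by omega))⟩,
    ?_, ?_, ?_⟩
  · exact (hρs _).convolution L (hφ.compact.mul_left)
  · intro hu0 hφ0 n x
    change 0 ≤ (ρ (n + n₀) ⋆[L] w) x
    rw [convolution_eq_swap]
    refine integral_nonneg_of_ae ?_
    have h4 := (ae_restrict_iff' hU.measurableSet).1 hu0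
    filter_upwards [h4] with y hy
    have : 0 ≤ w y := by
      by_cases hyU : y ∈ U
      · exact mul_nonneg (hy hyU) (hφ0 y)
      · simp [hw, hφ.eq_zero hyU]
    simpa [hL] using mul_nonneg ((mollifier (E N) (n + n₀)).nonneg_normed _) this
  · intro g hg
    have h5 := (tendsto_integral_mul_convolution hw2 (hind g hg)).comp (tendsto_add_atTop_nat n₀)
    simpa only [hset] using! h5
  · intro g v hg
    have h5 := (tendsto_integral_mul_convolution (hH2 v) (hind g hg)).comp
      (tendsto_add_atTop_nat n₀)
    simp only [hder]
    simpa only [hset] using! h5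

theorem inner_single_one (x : E N) (i : Fin N) :
    ⟪x, EuclideanSpace.single i (1 : ℝ)⟫ = x i := by
  simp [EuclideanSpace.inner_single_right]

theorem inner_eq_sum_inner_single (x y : E N) :
    ⟪x, y⟫ = ∑ i, ⟪x, EuclideanSpace.single i (1 : ℝ)⟫ * y i := by
  simp [PiLp.inner_apply, mul_comm]

theorem inner_gradient_eq_sum (x y : E N) :
    ⟪x, gradient φ y⟫
      = ∑ i, ⟪x, EuclideanSpace.single i (1 : ℝ)⟫ *
          fderiv ℝ φ y (EuclideanSpace.single i (1 : ℝ)) := by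
  rw [inner_eq_sum_inner_single]
  refine Finset.sum_congr rfl fun i _ => ?_
  rw [← inner_gradient_left (𝕜 := ℝ)]
  simp only [inner_single_one]

/-- Testing subharmonicity of a nonnegative `u` with `u φ`, `φ ≥ 0`: weakly,
`Δ (u² / 2) ≥ |∇u|²`. -/
theorem IsH1.caccioppoli (hU : IsOpen U) (hu : IsH1 U u G) (hsub : WeaklySubharmonic U G)
    (hu0 : ∀ᵐ x ∂(volume.restrict U), 0 ≤ u x) (hφ : IsTest U φ) (hφ0 : ∀ x, 0 ≤ φ x) :
    ∫ x in U, (‖G x‖ ^ 2 * φ x + u x * ⟪G x, gradient φ x⟫) ≤ 0 := by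
  obtain ⟨Φ, hΦ, hΦ0, -, hlim⟩ := hu.exists_test_approx hU hφ
  have hi : ∀ (i : Fin N) (n : ℕ), Integrable (fun x =>
      ⟪G x, EuclideanSpace.single i (1 : ℝ)⟫ *
        fderiv ℝ (Φ n) x (EuclideanSpace.single i (1 : ℝ))) (volume.restrict U) := fun i n =>
    integrable_mul_of_continuous (hu.memLp_inner _) ((hΦ n).continuous_fderiv _)
      ((hΦ n).hasCompactSupport_fderiv _)
  have hi' : ∀ i : Fin N, Integrable (fun x => ⟪G x, EuclideanSpace.single i (1 : ℝ)⟫ *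
      (⟪G x, EuclideanSpace.single i (1 : ℝ)⟫ * φ x
        + u x * fderiv ℝ φ x (EuclideanSpace.single i (1 : ℝ)))) (volume.restrict U) := fun i =>
    (hu.memLp_inner _).integrable_mul (q := 2)
      ((memLp_mul_of_continuous (hu.memLp_inner _) hφ.smooth.continuous hφ.compact).add
        (memLp_mul_of_continuous hu.memLp (hφ.continuous_fderiv _)
          (hφ.hasCompactSupport_fderiv _)))
  have hle : ∀ n, ∑ i : Fin N, ∫ x in U, ⟪G x, EuclideanSpace.single i (1 : ℝ)⟫ *
      fderiv ℝ (Φ n) x (EuclideanSpace.single i (1 : ℝ)) ≤ 0 := by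
    intro n
    rw [← integral_finsetSum _ fun i _ => hi i n]
    simpa only [inner_gradient_eq_sum] using hsub _ (hΦ n) (hΦ0 hu0 hφ0 n)
  have hl := tendsto_finsetSum (Finset.univ : Finset (Fin N)) fun i _ =>
    hlim _ (EuclideanSpace.single i (1 : ℝ)) (hu.memLp_inner (EuclideanSpace.single i (1 : ℝ)))
  have h := le_of_tendsto' hl hle
  rw [← integral_finsetSum _ fun i _ => hi' i] at h
  refine le_of_eq_of_le (integral_congr_ae (Eventually.of_forall fun x => ?_)) h
  simp only [inner_gradient_eq_sum, mul_add, Finset.sum_add_distrib]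
  congr 1
  · rw [← real_inner_self_eq_norm_sq, inner_eq_sum_inner_single, Finset.sum_mul]
    refine Finset.sum_congr rfl fun i _ => ?_
    rw [inner_single_one]; ring
  · rw [Finset.mul_sum]
    exact Finset.sum_congr rfl fun i _ => by ring

/-- `u²` has weak gradient `2 u ∇u`. -/
theorem IsH1.sq_by_parts (hU : IsOpen U) (hu : IsH1 U u G) (hφ : IsTest U φ) (v : E N) :
    ∫ x in U, u x ^ 2 * fderiv ℝ φ x v = -∫ x in U, φ x * ⟪(2 * u x) • G x, v⟫ := by
  obtain ⟨Φ, hΦ, -, hlim0, hlim⟩ := hu.exists_test_approx hU hφ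
  -- both sides of the weak formulation for `u`, tested with the approximations of `u φ`
  have h1 := hlim u v hu.memLp
  have h2 := (hlim0 _ (hu.memLp_inner v)).neg
  have h3 : ∀ n, ∫ x in U, u x * fderiv ℝ (Φ n) x v = -∫ x in U, ⟪G x, v⟫ * Φ n x := by
    intro n
    rw [hu.by_parts _ (hΦ n) v]
    simp_rw [mul_comm]
  simp_rw [h3] at h1
  have h := tendsto_nhds_unique h1 h2
  have i1 : Integrable (fun x => u x * (⟪G x, v⟫ * φ x)) (volume.restrict U) :=
    hu.memLp.integrable_mul (q := 2) (memLp_mul_of_continuous (hu.memLp_inner v)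
      hφ.smooth.continuous hφ.compact)
  have i2 : Integrable (fun x => u x * (u x * fderiv ℝ φ x v)) (volume.restrict U) :=
    hu.memLp.integrable_mul (q := 2) (memLp_mul_of_continuous hu.memLp
      (hφ.continuous_fderiv v) (hφ.hasCompactSupport_fderiv v))
  simp_rw [mul_add] at h
  rw [integral_add i1 i2] at h
  have e1 : ∫ x in U, u x ^ 2 * fderiv ℝ φ x v = ∫ x in U, u x * (u x * fderiv ℝ φ x v) := by
    simp_rw [sq, mul_assoc]
  have e2 : ∫ x in U, φ x * ⟪(2 * u x) • G x, v⟫ = 2 * ∫ x in U, u x * (⟪G x, v⟫ * φ x) := by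
    rw [← integral_const_mul]
    refine integral_congr_ae (Eventually.of_forall fun x => ?_)
    simp only [inner_smul_left]; simp; ring
  have e3 : ∫ x in U, ⟪G x, v⟫ * (u x * φ x) = ∫ x in U, u x * (⟪G x, v⟫ * φ x) := by
    refine integral_congr_ae (Eventually.of_forall fun x => ?_)
    simp only; ring
  rw [e1, e2]
  rw [e3] at h
  linarith

/-- The divergence of a vector field on `E N`. -/
noncomputable def divergence {N : ℕ} (Z : E N → E N) (x : E N) : ℝ :=
  ∑ i : Fin N, (fderiv ℝ Z x (EuclideanSpace.single i (1 : ℝ))) i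

/-- Integration by parts against scalar test functions implies integration by parts against
compactly supported vector fields. -/
theorem integral_mul_divergence {f : E N → ℝ} {F : E N → E N} (hf : IntegrableOn f U)
    (hF : IntegrableOn F U)
    (hparts : ∀ φ, IsTest U φ → ∀ v : E N,
      ∫ x in U, f x * fderiv ℝ φ x v = -∫ x in U, φ x * ⟪F x, v⟫)
    {Z : E N → E N} (hZ : ContDiff ℝ ∞ Z) (hZc : HasCompactSupport Z) (hZU : tsupport Z ⊆ U) :
    ∫ x in U, f x * divergence Z x = -∫ x in U, ⟪F x, Z x⟫ := by
  have hZi : ∀ i : Fin N, ContDiff ℝ ∞ fun x => Z x i := fun i => by fun_prop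
  have hsub : ∀ i : Fin N, tsupport (fun x => Z x i) ⊆ tsupport Z := fun i =>
    closure_mono fun x hx hx' => hx (by simp [hx'])
  have ht : ∀ i : Fin N, IsTest U fun x => Z x i := fun i =>
    ⟨hZi i, hZc.of_isClosed_subset (isClosed_tsupport _) (hsub i), (hsub i).trans hZU⟩
  have hd : ∀ (i : Fin N) x v, fderiv ℝ (fun x => Z x i) x v = (fderiv ℝ Z x v) i := by
    intro i x v
    have h1 : HasFDerivAt (fun x => Z x i)
        ((EuclideanSpace.proj i : E N →L[ℝ] ℝ).comp (fderiv ℝ Z x)) x :=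
      (EuclideanSpace.proj i : E N →L[ℝ] ℝ).hasFDerivAt.comp x
        (hZ.differentiable (by simp) x).hasFDerivAt
    rw [h1.fderiv]; simp
  have i1 : ∀ i : Fin N, Integrable (fun x => f x *
      (fderiv ℝ Z x (EuclideanSpace.single i (1 : ℝ))) i) (volume.restrict U) := by
    intro i
    simp_rw [← hd]
    obtain ⟨C, hC⟩ := ((ht i).hasCompactSupport_fderiv
      (EuclideanSpace.single i (1 : ℝ))).exists_bound_of_continuous ((ht i).continuous_fderiv _)
    exact hf.mul_bdd (c := C) ((ht i).continuous_fderiv _).aestronglyMeasurable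
      (Eventually.of_forall hC)
  have i2 : ∀ i : Fin N, Integrable (fun x => Z x i * ⟪F x, EuclideanSpace.single i (1 : ℝ)⟫)
      (volume.restrict U) := by
    intro i
    obtain ⟨C, hC⟩ := (ht i).compact.exists_bound_of_continuous (hZi i).continuous
    exact (hF.inner_const _).bdd_mul (c := C) (hZi i).continuous.aestronglyMeasurable
      (Eventually.of_forall hC)
  simp_rw [divergence, Finset.mul_sum]
  rw [integral_finsetSum _ fun i _ => i1 i]
  have h : ∀ i : Fin N, ∫ x in U, f x * (fderiv ℝ Z x (EuclideanSpace.single i (1 : ℝ))) i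
      = -∫ x in U, Z x i * ⟪F x, EuclideanSpace.single i (1 : ℝ)⟫ := by
    intro i
    simp_rw [← hd]
    exact hparts _ (ht i) _
  simp_rw [h, Finset.sum_neg_distrib]
  rw [← integral_finsetSum _ fun i _ => i2 i]
  congr 1
  refine integral_congr_ae (Eventually.of_forall fun x => ?_)
  simp only
  rw [inner_eq_sum_inner_single]
  simp_rw [mul_comm]

end Basic

/-! ### Polar coordinates -/

/-- The radial part `r ^ (N - 1) dr` of Lebesgue measure in polar coordinates. -/
noncomputable def radialMeasure (N : ℕ) : Measure ℝ :=
  (volume.restrict (Ioi 0)).withDensity fun r => ENNReal.ofReal (r ^ (N - 1))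

instance (N : ℕ) : SFinite (radialMeasure N) := by
  unfold radialMeasure; infer_instance

instance (N : ℕ) : IsFiniteMeasure (surf N) := by
  unfold surf; infer_instance

theorem map_volumeIoiPow (n : ℕ) :
    (Measure.volumeIoiPow n).map (Subtype.val : Ioi (0 : ℝ) → ℝ)
      = (volume.restrict (Ioi 0)).withDensity fun r => ENNReal.ofReal (r ^ n) := by
  have hm : Measurable fun r : ℝ => ENNReal.ofReal (r ^ n) := by fun_prop
  ext s hs
  rw [Measure.map_apply measurable_subtype_coe hs, Measure.volumeIoiPow,
    withDensity_apply _ (measurable_subtype_coe hs), withDensity_apply _ hs,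
    ← map_comap_subtype_coe measurableSet_Ioi,
    setLIntegral_map hs hm measurable_subtype_coe]

theorem ae_radialMeasure_iff {N : ℕ} {p : ℝ → Prop} :
    (∀ᵐ r ∂(radialMeasure N), p r) ↔ ∀ᵐ r ∂(volume.restrict (Ioi (0 : ℝ))), p r := by
  have hm : Measurable fun r : ℝ => ENNReal.ofReal (r ^ (N - 1)) := by fun_prop
  rw [radialMeasure, ae_withDensity_iff hm]
  constructor
  · intro h
    filter_upwards [h, ae_restrict_mem measurableSet_Ioi] with r hr hr0
    exact hr (by simpa using pow_pos hr0 (N - 1))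
  · intro h
    filter_upwards [h] with r hr _ using hr

theorem integrable_radialMeasure_iff {N : ℕ} {f : ℝ → ℝ} :
    Integrable f (radialMeasure N) ↔ IntegrableOn (fun r => r ^ (N - 1) * f r) (Ioi 0) := by
  have hm : Measurable fun r : ℝ => ENNReal.ofReal (r ^ (N - 1)) := by fun_prop
  rw [radialMeasure, integrable_withDensity_iff_integrable_smul' hm (by simp), IntegrableOn]
  refine integrable_congr ?_
  filter_upwards [ae_restrict_mem measurableSet_Ioi] with r hr
  rw [ENNReal.toReal_ofReal (pow_nonneg (le_of_lt hr) _), smul_eq_mul]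

theorem integral_radialMeasure {N : ℕ} {f : ℝ → ℝ} :
    ∫ r, f r ∂(radialMeasure N) = ∫ r in Ioi 0, r ^ (N - 1) * f r := by
  have hm : Measurable fun r : ℝ => ENNReal.ofReal (r ^ (N - 1)) := by fun_prop
  rw [radialMeasure, integral_withDensity_eq_integral_toReal_smul hm (by simp)]
  refine integral_congr_ae ?_
  filter_upwards [ae_restrict_mem measurableSet_Ioi] with r hr
  rw [ENNReal.toReal_ofReal (pow_nonneg (le_of_lt hr) _), smul_eq_mul]

section Polar

variable {N : ℕ} [NeZero N]

/-- Polar coordinates, on `ℝ × S` instead of `(0, ∞) × S`: the radial measure does not charge the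
other radii. -/
theorem measurePreserving_polar :
    MeasurePreserving (fun p : ℝ × S N => p.1 • (p.2 : E N))
      ((radialMeasure N).prod (surf N)) volume := by
  have hN : 0 < N := NeZero.pos N
  have : Nontrivial (E N) := by
    have : Nonempty (Fin N) := ⟨⟨0, hN⟩⟩
    infer_instance
  have hmeas : Measurable fun p : ℝ × S N => p.1 • (p.2 : E N) := by fun_prop
  refine ⟨hmeas, ?_⟩
  have h1 := (volume : Measure (E N)).measurePreserving_homeomorphUnitSphereProd
  have h2 : MeasurePreserving (homeomorphUnitSphereProd (E N)).symm
      ((surf N).prod (Measure.volumeIoiPow (N - 1)))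
      ((volume : Measure (E N)).comap (Subtype.val : ({0}ᶜ : Set (E N)) → E N)) := by
    have h := h1.symm (homeomorphUnitSphereProd (E N)).toMeasurableEquiv
    simpa [surf] using h
  have h3 : MeasurePreserving (Subtype.val : ({0}ᶜ : Set (E N)) → E N)
      ((volume : Measure (E N)).comap Subtype.val) volume := by
    refine ⟨measurable_subtype_coe, ?_⟩
    rw [map_comap_subtype_coe (measurableSet_singleton _).compl]
    exact Measure.restrict_eq_self_of_ae_mem (by simp [ae_iff])
  have h4 := (h3.comp h2).comp Measure.measurePreserving_swap
  have h5 : (radialMeasure N).prod (surf N)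
      = ((Measure.volumeIoiPow (N - 1)).prod (surf N)).map
        (Prod.map (Subtype.val : Ioi (0 : ℝ) → ℝ) id) := by
    rw [← Measure.map_prod_map _ _ measurable_subtype_coe measurable_id, map_volumeIoiPow,
      Measure.map_id]
    rfl
  rw [h5, Measure.map_map hmeas (measurable_subtype_coe.prodMap measurable_id)]
  rw [← h4.map_eq]
  congr 1

theorem ae_ae_polar {p : E N → Prop} (h : ∀ᵐ x, p x) :
    ∀ᵐ r ∂(volume.restrict (Ioi (0 : ℝ))), ∀ᵐ ξ : S N ∂(surf N), p (r • (ξ : E N)) := by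
  have h1 : ∀ᵐ q ∂((radialMeasure N).prod (surf N)), p (q.1 • (q.2 : E N)) :=
    measurePreserving_polar.quasiMeasurePreserving.ae h
  exact ae_radialMeasure_iff.1 (Measure.ae_ae_of_ae_prod h1)

/-- The integral of `f` over the sphere of radius `r`, with respect to the surface measure of
the unit sphere. -/
noncomputable def sphereIntegral (f : E N → ℝ) (r : ℝ) : ℝ :=
  ∫ ξ, f (r • (ξ : E N)) ∂(surf N)

theorem integrable_comp_polar {F : Type*} [NormedAddCommGroup F] {f : E N → F}
    (hf : Integrable f) :
    Integrable (fun p : ℝ × S N => f (p.1 • (p.2 : E N))) ((radialMeasure N).prod (surf N)) :=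
  measurePreserving_polar.integrable_comp_of_integrable hf

theorem ae_integrable_slice {F : Type*} [NormedAddCommGroup F] {f : E N → F}
    (hf : Integrable f) :
    ∀ᵐ r ∂(volume.restrict (Ioi (0 : ℝ))),
      Integrable (fun ξ : S N => f (r • (ξ : E N))) (surf N) :=
  ae_radialMeasure_iff.1 (integrable_comp_polar hf).prod_right_ae

theorem integrableOn_sphereIntegral {f : E N → ℝ} (hf : Integrable f) :
    IntegrableOn (fun r => r ^ (N - 1) * sphereIntegral f r) (Ioi 0) :=
  integrable_radialMeasure_iff.1 (integrable_comp_polar hf).integral_prod_left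

theorem integral_eq_integral_sphereIntegral {f : E N → ℝ} (hf : Integrable f) :
    ∫ x, f x = ∫ r in Ioi 0, r ^ (N - 1) * sphereIntegral f r := by
  have h1 := integral_prod _ (integrable_comp_polar hf)
  have hm : AEStronglyMeasurable f
      (((radialMeasure N).prod (surf N)).map fun p : ℝ × S N => p.1 • (p.2 : E N)) := by
    rw [measurePreserving_polar.map_eq]; exact hf.1
  rw [← integral_map measurePreserving_polar.aemeasurable hm,
    measurePreserving_polar.map_eq] at h1
  rw [h1, integral_radialMeasure]
  rfl

theorem ae_memLp_slice {F : Type*} [NormedAddCommGroup F] {f : E N → F} (hf : MemLp f 2) :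
    ∀ᵐ r ∂(volume.restrict (Ioi (0 : ℝ))),
      MemLp (fun ξ : S N => f (r • (ξ : E N))) 2 (surf N) := by
  have h1 : AEStronglyMeasurable (fun p : ℝ × S N => f (p.1 • (p.2 : E N)))
      ((radialMeasure N).prod (surf N)) :=
    hf.1.comp_quasiMeasurePreserving measurePreserving_polar.quasiMeasurePreserving
  have h2 := ae_radialMeasure_iff.1 h1.prodMk_left
  have h3 := ae_integrable_slice ((memLp_two_iff_integrable_sq_norm hf.1).1 hf)
  filter_upwards [h2, h3] with r h2 h3
  exact (memLp_two_iff_integrable_sq_norm h2).2 h3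

end Polar

/-! ### Test fields in polar form -/

section RadialField

variable {N : ℕ} {ψ : ℝ → ℝ} {X : E N → E N} {T : ℝ}

theorem hasFDerivAt_norm_of_ne_zero {x : E N} (hx : x ≠ 0) :
    HasFDerivAt (fun y : E N => ‖y‖) (‖x‖⁻¹ • innerSL ℝ x) x := by
  have h1 := ((hasStrictFDerivAt_norm_sq x).hasFDerivAt).sqrt
    (by simpa using hx)
  have h2 : (fun y : E N => √(‖y‖ ^ 2)) = fun y => ‖y‖ := by
    ext y; exact Real.sqrt_sq (norm_nonneg y)
  rw [h2] at h1
  refine h1.congr_fderiv ?_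
  rw [Real.sqrt_sq (norm_nonneg x), ← Nat.cast_smul_eq_nsmul ℝ, smul_smul]
  congr 1
  have : ‖x‖ ≠ 0 := by simpa using hx
  field_simp
  norm_num

/-- The vector field `ψ(|x|) X(x / |x|)`. -/
noncomputable def radialField (ψ : ℝ → ℝ) (X : E N → E N) (x : E N) : E N :=
  ψ ‖x‖ • X (‖x‖⁻¹ • x)

theorem eventually_norm_notMem (hψT : tsupport ψ ⊆ Ioo 0 T) :
    ∀ᶠ x : E N in 𝓝 0, ψ ‖x‖ = 0 := by
  have h0 : (0 : ℝ) ∉ tsupport ψ := fun h => lt_irrefl _ (hψT h).1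
  have h1 : ∀ᶠ r in 𝓝 (0 : ℝ), ψ r = 0 := by
    filter_upwards [(isClosed_tsupport ψ).isOpen_compl.mem_nhds h0] with r hr
    exact image_eq_zero_of_notMem_tsupport hr
  have h2 : Tendsto (fun x : E N => ‖x‖) (𝓝 0) (𝓝 0) := by
    simpa using (continuous_norm (E := E N)).tendsto 0
  exact h2.eventually h1

theorem contDiff_radialField (hψ : ContDiff ℝ ∞ ψ) (hψT : tsupport ψ ⊆ Ioo 0 T)
    (hX : ContDiff ℝ ∞ X) : ContDiff ℝ ∞ (radialField ψ X) := by
  rw [contDiff_iff_contDiffAt]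
  intro x
  by_cases hx : x = 0
  · subst hx
    refine (contDiffAt_const (c := (0 : E N))).congr_of_eventuallyEq ?_
    filter_upwards [eventually_norm_notMem hψT] with y hy
    simp [radialField, hy]
  · have hn : ContDiffAt ℝ ∞ (fun y : E N => ‖y‖) x := contDiffAt_norm ℝ hx
    refine (hψ.contDiffAt.comp x hn).smul (hX.contDiffAt.comp x ?_)
    exact (hn.inv (by simpa using hx)).smul contDiffAt_id

theorem tsupport_radialField_subset :
    tsupport (radialField ψ X) ⊆ (fun x : E N => ‖x‖) ⁻¹' tsupport ψ := by
  refine closure_minimal (fun x hx => subset_closure ?_)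
    ((isClosed_tsupport ψ).preimage continuous_norm)
  exact fun h => hx (by simp [radialField, h])

theorem tsupport_radialField_subset_ball (hψT : tsupport ψ ⊆ Ioo 0 T) :
    tsupport (radialField ψ X) ⊆ ball 0 T := fun x hx => by
  simpa using (hψT (tsupport_radialField_subset hx)).2

theorem hasCompactSupport_radialField (hψT : tsupport ψ ⊆ Ioo 0 T) :
    HasCompactSupport (radialField ψ X) :=
  (isCompact_closedBall (0 : E N) T).of_isClosed_subset (isClosed_tsupport _)
    ((tsupport_radialField_subset_ball hψT).trans ball_subset_closedBall)

theorem norm_smul_sphere {r : ℝ} (hr : 0 < r) (ξ : S N) : ‖r • (ξ : E N)‖ = r := by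
  simp [norm_smul, abs_of_pos hr]

theorem radialField_smul {r : ℝ} (hr : 0 < r) (ξ : S N) :
    radialField ψ X (r • (ξ : E N)) = ψ r • X ξ := by
  rw [radialField, norm_smul_sphere hr, smul_smul, inv_mul_cancel₀ hr.ne', one_smul]

theorem inner_self_sphere (ξ : S N) : ⟪(ξ : E N), (ξ : E N)⟫ = 1 := by
  rw [real_inner_self_eq_norm_sq]; simp

/-- At `r ξ` the radial part of `X` contributes through the derivative of `ψ`, while `X(x / |x|)`
is homogeneous of degree zero, so that its divergence is the spherical divergence divided
by `r`. -/
theorem divergence_radialField (hψ : ContDiff ℝ ∞ ψ) (hX : ContDiff ℝ ∞ X) {r : ℝ} (hr : 0 < r)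
    (ξ : S N) : divergence (radialField ψ X) (r • (ξ : E N))
      = deriv ψ r * ⟪X ξ, (ξ : E N)⟫ + ψ r * (r⁻¹ * sphereDiv X ξ) := by
  set x : E N := r • (ξ : E N) with hx
  have hxr : ‖x‖ = r := norm_smul_sphere hr ξ
  have hx0 : x ≠ 0 := by rw [← norm_ne_zero_iff, hxr]; exact hr.ne'
  have hξ : ‖x‖⁻¹ • x = ξ := by rw [hxr, hx, smul_smul, inv_mul_cancel₀ hr.ne', one_smul]
  have hn := hasFDerivAt_norm_of_ne_zero hx0
  have h1 : HasFDerivAt (fun y : E N => ψ ‖y‖) (deriv ψ ‖x‖ • (‖x‖⁻¹ • innerSL ℝ x)) x :=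
    ((hψ.differentiable (by simp)).differentiableAt.hasDerivAt).comp_hasFDerivAt x hn
  have h2 : HasFDerivAt (fun y : E N => ‖y‖⁻¹ • y) _ x :=
    ((hasDerivAt_inv (norm_ne_zero_iff.2 hx0)).comp_hasFDerivAt x hn).smul (hasFDerivAt_id x)
  have h3 : HasFDerivAt X (fderiv ℝ X (ξ : E N)) (‖x‖⁻¹ • x) := by
    rw [hξ]; exact (hX.differentiable (by simp) _).hasFDerivAt
  have h4 := h1.smul (HasFDerivAt.comp (g := X) (f := fun y : E N => ‖y‖⁻¹ • y) x h3 h2)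
  have h5 : ∀ v, fderiv ℝ (radialField ψ X) x v
      = (deriv ψ r * ⟪(ξ : E N), v⟫) • X ξ
        + (ψ r * r⁻¹) • (fderiv ℝ X ξ v - ⟪(ξ : E N), v⟫ • fderiv ℝ X ξ ξ) := by
    intro v
    have h6 : fderiv ℝ (radialField ψ X) x = _ := h4.fderiv
    rw [h6]
    have h7 : ⟪x, v⟫ = r * ⟪(ξ : E N), v⟫ := by rw [hx, inner_smul_left]; simp
    simp only [add_apply, smul_apply,
      ContinuousLinearMap.smulRight_apply, ContinuousLinearMap.comp_apply, Function.comp_apply,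
      innerSL_apply_apply, ContinuousLinearMap.id_apply, smul_eq_mul, hxr, h7, map_add,
      map_smul]
    have h8 : r⁻¹ • x = ξ := by rw [← hxr, hξ]
    rw [h8, hx, map_smul, smul_smul]
    have e1 : r⁻¹ * (r * ⟪(ξ : E N), v⟫) = ⟪(ξ : E N), v⟫ := by field_simp
    have e2 : -(r ^ 2)⁻¹ * ⟪(ξ : E N), v⟫ * r = - (r⁻¹ * ⟪(ξ : E N), v⟫) := by
      field_simp
    rw [e1, e2, add_comm]
    module
  simp only [divergence, h5, sphereDiv]
  have h6 : ∀ i : Fin N, ⟪(ξ : E N), EuclideanSpace.single i (1 : ℝ)⟫ = (ξ : E N) i := fun i =>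
    inner_single_one _ i
  have h7 : ∀ y : E N, ⟪y, (ξ : E N)⟫ = ∑ i, (ξ : E N) i * y i := fun y => by
    simp [PiLp.inner_apply]
  simp only [h6, h7, PiLp.add_apply, PiLp.smul_apply, PiLp.sub_apply, smul_eq_mul,
    Finset.sum_add_distrib, mul_sub, Finset.sum_sub_distrib, Finset.mul_sum]
  congr 1
  · exact Finset.sum_congr rfl fun i _ => by ring
  · congr 1 <;> exact Finset.sum_congr rfl fun i _ => by ring

end RadialField

/-! ### Spherical slices of `H¹` functions -/

/-- `u ∈ H¹` of the ball of radius `T` around the origin, with weak gradient `G`, where both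
functions are extended by zero outside the ball. -/
structure IsH1Ball {N : ℕ} (T : ℝ) (u : E N → ℝ) (G : E N → E N) : Prop where
  isH1 : IsH1 (ball 0 T) u G
  zero : ∀ x ∉ ball 0 T, u x = 0
  grad_zero : ∀ x ∉ ball 0 T, G x = 0

section Slices

variable {N : ℕ} {T : ℝ} {u : E N → ℝ} {G : E N → E N}

theorem IsH1Ball.memLp (hu : IsH1Ball T u G) : MemLp u 2 :=
  memLp_of_restrict_of_eq_zero measurableSet_ball hu.isH1.memLp hu.zero

theorem IsH1Ball.memLp_grad (hu : IsH1Ball T u G) : MemLp G 2 :=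
  memLp_of_restrict_of_eq_zero measurableSet_ball hu.isH1.memLp_grad hu.grad_zero

theorem integrable_of_memLp_ball {F : Type*} [NormedAddCommGroup F] {f : E N → F}
    (hf : MemLp f 2 (volume.restrict (ball 0 T))) (h0 : ∀ x ∉ ball 0 T, f x = 0) :
    Integrable f := by
  have : IsFiniteMeasure (volume.restrict (ball (0 : E N) T)) :=
    ⟨by simpa using measure_ball_lt_top⟩
  refine (integrableOn_iff_integrable_of_support_subset (s := ball (0 : E N) T)
    fun x hx => ?_).1 (hf.integrable (by norm_num))
  by_contra h
  exact hx (h0 x h)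

theorem IsH1Ball.integrable (hu : IsH1Ball T u G) : Integrable u :=
  integrable_of_memLp_ball hu.isH1.memLp hu.zero

theorem IsH1Ball.integrable_grad (hu : IsH1Ball T u G) : Integrable G :=
  integrable_of_memLp_ball hu.isH1.memLp_grad hu.grad_zero

theorem integrable_mul_continuous {μ : Measure (S N)} {w c : S N → ℝ} (hw : Integrable w μ)
    (hc : Continuous c) : Integrable (fun ξ => w ξ * c ξ) μ := by
  obtain ⟨C, hC⟩ := isCompact_univ.exists_bound_of_continuousOn hc.continuousOn
  exact hw.mul_bdd (c := C) hc.aestronglyMeasurable (Eventually.of_forall fun ξ => hC ξ trivial)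

theorem integrable_inner_continuous {μ : Measure (S N)} {w c : S N → E N} (hw : Integrable w μ)
    (hc : Continuous c) : Integrable (fun ξ => ⟪w ξ, c ξ⟫) μ := by
  obtain ⟨C, hC⟩ := isCompact_univ.exists_bound_of_continuousOn hc.continuousOn
  refine Integrable.mono' (hw.norm.mul_const C) (hw.1.inner hc.aestronglyMeasurable)
    (Eventually.of_forall fun ξ => ?_)
  refine (norm_inner_le_norm _ _).trans ?_
  gcongr
  exact hC ξ trivial

theorem continuous_divergence {Z : E N → E N} (hZ : ContDiff ℝ ∞ Z) :
    Continuous (divergence Z) := by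
  have h : ∀ v, Continuous fun x => fderiv ℝ Z x v := fun v =>
    (hZ.continuous_fderiv (by simp)).clm_apply continuous_const
  unfold divergence
  refine continuous_finsetSum _ fun i _ => ?_
  exact (EuclideanSpace.proj i : E N →L[ℝ] ℝ).continuous.comp (h _)

theorem continuous_sphereDiv {X : E N → E N} (hX : ContDiff ℝ ∞ X) :
    Continuous (sphereDiv X) := by
  have h : Continuous fun ξ : S N => fderiv ℝ X (ξ : E N) :=
    (hX.continuous_fderiv (by simp)).comp continuous_subtype_val
  unfold sphereDiv
  refine Continuous.sub (continuous_finsetSum _ fun i _ => ?_) ?_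
  · exact (EuclideanSpace.proj i : E N →L[ℝ] ℝ).continuous.comp (h.clm_apply continuous_const)
  · exact (h.clm_apply continuous_subtype_val).inner continuous_subtype_val

/-- Integration by parts on a ball against a field `ψ(|x|) X(x / |x|)`, in polar coordinates. -/
theorem integral_polar_by_parts [NeZero N] {f : E N → ℝ} {F : E N → E N} (hf : Integrable f)
    (hF : Integrable F)
    (hparts : ∀ φ, IsTest (ball 0 T) φ → ∀ v : E N,
      ∫ x in ball 0 T, f x * fderiv ℝ φ x v = -∫ x in ball 0 T, φ x * ⟪F x, v⟫)
    {ψ : ℝ → ℝ} (hψ : ContDiff ℝ ∞ ψ) (hψT : tsupport ψ ⊆ Ioo 0 T) {X : E N → E N}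
    (hX : ContDiff ℝ ∞ X) :
    ∫ r in Ioi 0, r ^ (N - 1) *
      (deriv ψ r * (∫ ξ : S N, f (r • (ξ : E N)) * ⟪X ξ, (ξ : E N)⟫ ∂(surf N))
        + ψ r * (r⁻¹ * (∫ ξ : S N, f (r • (ξ : E N)) * sphereDiv X ξ ∂(surf N))
          + ∫ ξ : S N, ⟪F (r • (ξ : E N)), X ξ⟫ ∂(surf N))) = 0 := by
  set Z := radialField ψ X with hZ
  have hZc : ContDiff ℝ ∞ Z := contDiff_radialField hψ hψT hX
  have hZs : HasCompactSupport Z := hasCompactSupport_radialField hψT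
  have hZT : tsupport Z ⊆ ball 0 T := tsupport_radialField_subset_ball hψT
  have hdc := continuous_divergence hZc
  have hd0 : ∀ x ∉ tsupport Z, divergence Z x = 0 := by
    intro x hx
    have : fderiv ℝ Z x = 0 :=
      image_eq_zero_of_notMem_tsupport fun h => hx (tsupport_fderiv_subset ℝ h)
    simp [divergence, this]
  have hds : HasCompactSupport (divergence Z) := HasCompactSupport.intro hZs hd0
  have i1 : Integrable fun x => f x * divergence Z x := by
    obtain ⟨C, hC⟩ := hds.exists_bound_of_continuous hdc
    exact hf.mul_bdd (c := C) hdc.aestronglyMeasurable (Eventually.of_forall hC)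
  have i2 : Integrable fun x => ⟪F x, Z x⟫ := by
    obtain ⟨C, hC⟩ := hZs.exists_bound_of_continuous hZc.continuous
    refine Integrable.mono' (hF.norm.mul_const C)
      (hF.1.inner hZc.continuous.aestronglyMeasurable) (Eventually.of_forall fun x => ?_)
    refine (norm_inner_le_norm _ _).trans ?_
    gcongr
    exact hC x
  have h0 : ∫ x, (f x * divergence Z x + ⟪F x, Z x⟫) = 0 := by
    have h1 := integral_mul_divergence hf.integrableOn hF.integrableOn hparts hZc hZs hZT
    rw [setIntegral_eq_integral_of_forall_compl_eq_zero
        (fun x hx => by rw [hd0 x fun h => hx (hZT h), mul_zero]),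
      setIntegral_eq_integral_of_forall_compl_eq_zero
        (fun x hx => by
          rw [image_eq_zero_of_notMem_tsupport fun h => hx (hZT h), inner_zero_right])] at h1
    rw [integral_add i1 i2, h1]; ring
  rw [integral_eq_integral_sphereIntegral
    (f := fun x => f x * divergence Z x + ⟪F x, Z x⟫) (i1.add i2)] at h0
  refine Eq.trans (integral_congr_ae ?_) h0
  filter_upwards [ae_restrict_mem measurableSet_Ioi, ae_integrable_slice hf,
    ae_integrable_slice hF] with r (hr : 0 < r) hfr hFr
  have c1 : Continuous fun ξ : S N => ⟪X ξ, (ξ : E N)⟫ :=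
    (hX.continuous.comp continuous_subtype_val).inner continuous_subtype_val
  have j1 := integrable_mul_continuous hfr c1
  have j2 := integrable_mul_continuous hfr (continuous_sphereDiv hX)
  have j3 := integrable_inner_continuous hFr (hX.continuous.comp continuous_subtype_val)
  congr 1
  simp only [sphereIntegral]
  rw [← integral_const_mul, ← integral_const_mul]
  have e : ∀ ξ : S N, f (r • (ξ : E N)) * divergence Z (r • (ξ : E N))
        + ⟪F (r • (ξ : E N)), Z (r • (ξ : E N))⟫
      = deriv ψ r * (f (r • (ξ : E N)) * ⟪X ξ, (ξ : E N)⟫)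
        + ψ r * (r⁻¹ * (f (r • (ξ : E N)) * sphereDiv X ξ) + ⟪F (r • (ξ : E N)), X ξ⟫) := by
    intro ξ
    rw [hZ, divergence_radialField hψ hX hr, radialField_smul hr, inner_smul_right]
    ring
  have j3' : Integrable (fun ξ : S N => ⟪F (r • (ξ : E N)), X ξ⟫) (surf N) := j3
  have j4 : Integrable (fun ξ : S N => ψ r * (r⁻¹ * (f (r • (ξ : E N)) * sphereDiv X ξ)
      + ⟪F (r • (ξ : E N)), X ξ⟫)) (surf N) := ((j2.const_mul _).add j3').const_mul _
  simp_rw [e]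
  rw [integral_add (j1.const_mul _) j4, integral_const_mul (ψ r),
    integral_add (j2.const_mul _) j3']

theorem integrableOn_integral_polar {g : ℝ × S N → ℝ}
    (hg : Integrable g ((radialMeasure N).prod (surf N))) :
    IntegrableOn (fun r => r ^ (N - 1) * ∫ ξ, g (r, ξ) ∂(surf N)) (Ioi 0) :=
  integrable_radialMeasure_iff.1 hg.integral_prod_left

theorem integrableOn_integral_mul_continuous [NeZero N] {f : E N → ℝ} (hf : Integrable f)
    {c : S N → ℝ} (hc : Continuous c) :
    IntegrableOn (fun r => r ^ (N - 1) * ∫ ξ : S N, f (r • (ξ : E N)) * c ξ ∂(surf N))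
      (Ioi 0) := by
  obtain ⟨C, hC⟩ := isCompact_univ.exists_bound_of_continuousOn hc.continuousOn
  exact integrableOn_integral_polar (g := fun p => f (p.1 • (p.2 : E N)) * c p.2)
    ((integrable_comp_polar hf).mul_bdd (c := C)
      (hc.comp continuous_snd).aestronglyMeasurable (Eventually.of_forall fun p => hC p.2 trivial))

theorem integrableOn_integral_inner_continuous [NeZero N] {F : E N → E N} (hF : Integrable F)
    {c : S N → E N} (hc : Continuous c) :
    IntegrableOn (fun r => r ^ (N - 1) * ∫ ξ : S N, ⟪F (r • (ξ : E N)), c ξ⟫ ∂(surf N))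
      (Ioi 0) := by
  obtain ⟨C, hC⟩ := isCompact_univ.exists_bound_of_continuousOn hc.continuousOn
  have hF' : Integrable (fun p : ℝ × S N => F (p.1 • (p.2 : E N)))
      ((radialMeasure N).prod (surf N)) := integrable_comp_polar hF
  have hc' : AEStronglyMeasurable (fun p : ℝ × S N => c p.2)
      ((radialMeasure N).prod (surf N)) := (hc.comp continuous_snd).aestronglyMeasurable
  have hm : AEStronglyMeasurable (fun p : ℝ × S N => ⟪F (p.1 • (p.2 : E N)), c p.2⟫)
      ((radialMeasure N).prod (surf N)) := hF'.1.inner (𝕜 := ℝ) hc'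
  have hb : ∀ p : ℝ × S N, ‖⟪F (p.1 • (p.2 : E N)), c p.2⟫‖ ≤ ‖F (p.1 • (p.2 : E N))‖ * C :=
    fun p => (norm_inner_le_norm _ _).trans
      (mul_le_mul_of_nonneg_left (hC p.2 trivial) (norm_nonneg _))
  have hi := (hF'.norm.mul_const C).mono' hm (Eventually.of_forall hb)
  exact integrableOn_integral_polar hi

/-- For a fixed tangential field, integration by parts holds on almost every sphere. -/
theorem ae_slice_by_parts [NeZero N] (hu : IsH1Ball T u G) {X : E N → E N}
    (hX : ContDiff ℝ ∞ X) (hXt : ∀ ξ : S N, ⟪X ξ, (ξ : E N)⟫ = 0) :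
    ∀ᵐ r : ℝ, r ∈ Ioo 0 T →
      r⁻¹ * (∫ ξ : S N, u (r • (ξ : E N)) * sphereDiv X ξ ∂(surf N))
        + ∫ ξ : S N, ⟪G (r • (ξ : E N)), X ξ⟫ ∂(surf N) = 0 := by
  set a : ℝ → ℝ := fun r => ∫ ξ : S N, u (r • (ξ : E N)) * sphereDiv X ξ ∂(surf N) with ha
  set b : ℝ → ℝ := fun r => ∫ ξ : S N, ⟪G (r • (ξ : E N)), X ξ⟫ ∂(surf N) with hb
  have i1 : IntegrableOn (fun r => r ^ (N - 1) * a r) (Ioi 0) :=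
    integrableOn_integral_mul_continuous hu.integrable (continuous_sphereDiv hX)
  have i2 : IntegrableOn (fun r => r ^ (N - 1) * b r) (Ioi 0) :=
    integrableOn_integral_inner_continuous hu.integrable_grad
      (hX.continuous.comp continuous_subtype_val)
  have hinv : ContinuousOn (fun r : ℝ => r⁻¹) (Ioo 0 T) :=
    continuousOn_inv₀.mono fun r hr => ne_of_gt hr.1
  have hloc : LocallyIntegrableOn (fun r => r⁻¹ * (r ^ (N - 1) * a r) + r ^ (N - 1) * b r)
      (Ioo 0 T) :=
    (LocallyIntegrableOn.continuousOn_mul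
      ((i1.mono_set Ioo_subset_Ioi_self).locallyIntegrableOn) hinv isOpen_Ioo.isLocallyClosed).add
      ((i2.mono_set Ioo_subset_Ioi_self).locallyIntegrableOn)
  have h : ∀ᵐ r : ℝ, r ∈ Ioo 0 T → r⁻¹ * (r ^ (N - 1) * a r) + r ^ (N - 1) * b r = 0 :=
      isOpen_Ioo.ae_eq_zero_of_integral_contDiff_smul_eq_zero hloc (fun ψ hψ _ hψT => by
    have h1 := integral_polar_by_parts hu.integrable hu.integrable_grad hu.isH1.by_parts hψ hψT hX
    simp only [hXt, mul_zero, integral_zero, zero_add] at h1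
    rw [← setIntegral_eq_integral_of_forall_compl_eq_zero (s := Ioi 0)
      (fun r hr => by
        rw [image_eq_zero_of_notMem_tsupport fun h => hr (hψT h).1, zero_smul])]
    refine Eq.trans (integral_congr_ae (Eventually.of_forall fun r => ?_)) h1
    simp only [smul_eq_mul, ha, hb]; ring)
  filter_upwards [h] with r hr hrT
  have h2 : r ^ (N - 1) * (r⁻¹ * a r + b r) = 0 := by rw [← hr hrT]; ring
  exact (mul_eq_zero.1 h2).resolve_left (pow_pos hrT.1 _).ne'

theorem inner_real (a b : ℝ) : ⟪a, b⟫ = a * b := by simp [mul_comm]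

theorem continuous_integral_inner_continuousMap {F : Type*} [NormedAddCommGroup F]
    [InnerProductSpace ℝ F] {μ : Measure (S N)} {w : S N → F} (hw : Integrable w μ) :
    Continuous fun c : C(S N, F) => ∫ ξ, ⟪w ξ, c ξ⟫ ∂μ := by
  have hi : ∀ c : C(S N, F), Integrable (fun ξ => ⟪w ξ, c ξ⟫) μ := by
    intro c
    refine Integrable.mono' (hw.norm.mul_const ‖c‖)
      (hw.1.inner c.continuous.aestronglyMeasurable_of_compactSpace)
      (Eventually.of_forall fun ξ => ?_)
    refine (norm_inner_le_norm _ _).trans ?_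
    gcongr
    exact c.norm_coe_le_norm ξ
  refine LipschitzWith.continuous (K := (∫ ξ, ‖w ξ‖ ∂μ).toNNReal)
    (LipschitzWith.of_dist_le_mul fun c d => ?_)
  rw [Real.dist_eq, ← integral_sub (hi c) (hi d)]
  rw [Real.coe_toNNReal _ (integral_nonneg fun ξ => norm_nonneg _), ← integral_mul_const]
  refine (norm_integral_le_integral_norm (f := fun ξ => ⟪w ξ, c ξ⟫ - ⟪w ξ, d ξ⟫)).trans
    (integral_mono_of_nonneg (Eventually.of_forall fun ξ => norm_nonneg _)
      (hw.norm.mul_const _) (Eventually.of_forall fun ξ => ?_))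
  simp only
  rw [← inner_sub_right]
  refine (norm_inner_le_norm _ _).trans ?_
  gcongr
  rw [← dist_eq_norm]
  exact ContinuousMap.dist_apply_le_dist ξ

/-- Almost every spherical slice of an `H¹` function is in `H¹` of the sphere. The exceptional
set of radii can be chosen independently of the test field, because `C(S)` is separable. -/
theorem ae_isH1Sphere_slice [NeZero N] (hu : IsH1Ball T u G) :
    ∀ᵐ r : ℝ, r ∈ Ioo 0 T →
      IsH1Sphere (fun ξ : S N => u (r • (ξ : E N)))
        (fun ξ : S N => r • (G (r • (ξ : E N))
          - ⟪G (r • (ξ : E N)), (ξ : E N)⟫ • (ξ : E N))) := by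
  -- the identity to be passed to the limit involves only the restrictions to the sphere of a
  -- field and of its divergence
  set 𝒯 : Set (C(S N, E N) × C(S N, ℝ)) := {p | ∃ X : E N → E N, ContDiff ℝ ∞ X ∧
    (∀ ξ : S N, ⟪X ξ, (ξ : E N)⟫ = 0) ∧ (∀ ξ : S N, p.1 ξ = X ξ) ∧
    ∀ ξ : S N, p.2 ξ = sphereDiv X ξ} with h𝒯
  obtain ⟨D, hD𝒯, hDc, hD⟩ :=
    (TopologicalSpace.IsSeparable.of_separableSpace 𝒯).exists_countable_dense_subset
  have h1 : ∀ᵐ r : ℝ, ∀ p ∈ D, r ∈ Ioo 0 T →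
      r⁻¹ * (∫ ξ : S N, ⟪u (r • (ξ : E N)), p.2 ξ⟫ ∂(surf N))
        + ∫ ξ : S N, ⟪G (r • (ξ : E N)), p.1 ξ⟫ ∂(surf N) = 0 := by
    rw [ae_ball_iff hDc]
    intro p hp
    obtain ⟨X, hX, hXt, hp1, hp2⟩ := hD𝒯 hp
    simp_rw [hp1, hp2, inner_real]
    exact ae_slice_by_parts hu hX hXt
  have m1 := (ae_restrict_iff' measurableSet_Ioi).1 (ae_memLp_slice hu.memLp)
  have m2 := (ae_restrict_iff' measurableSet_Ioi).1 (ae_memLp_slice hu.memLp_grad)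
  filter_upwards [h1, m1, m2] with r h1 m1 m2 hr
  specialize m1 hr.1
  specialize m2 hr.1
  have hξ : Continuous fun ξ : S N => (ξ : E N) := continuous_subtype_val
  have hrad : MemLp (fun ξ : S N => ⟪G (r • (ξ : E N)), (ξ : E N)⟫ • (ξ : E N)) 2 (surf N) := by
    refine m2.of_le ((m2.1.inner (𝕜 := ℝ) hξ.aestronglyMeasurable).smul hξ.aestronglyMeasurable)
      (Eventually.of_forall fun ξ => ?_)
    have := norm_inner_le_norm (𝕜 := ℝ) (G (r • (ξ : E N))) (ξ : E N)
    rw [norm_smul]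
    simpa using this
  refine ⟨m1, (m2.sub hrad).const_smul r, ?_, ?_⟩
  · refine Eventually.of_forall fun ξ => ?_
    rw [inner_smul_left, inner_sub_left, inner_smul_left, inner_self_sphere]
    simp
  · intro X hX hXt
    have hcont : Continuous fun p : C(S N, E N) × C(S N, ℝ) =>
        r⁻¹ * (∫ ξ : S N, ⟪u (r • (ξ : E N)), p.2 ξ⟫ ∂(surf N))
          + ∫ ξ : S N, ⟪G (r • (ξ : E N)), p.1 ξ⟫ ∂(surf N) :=
      (continuous_const.mul ((continuous_integral_inner_continuousMap
        (m1.integrable (by norm_num))).comp continuous_snd)).add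
        ((continuous_integral_inner_continuousMap
          (m2.integrable (by norm_num))).comp continuous_fst)
    have hcl := isClosed_singleton (x := (0 : ℝ)).preimage hcont
    have hX𝒯 : ((⟨fun ξ : S N => X ξ, hX.continuous.comp hξ⟩ : C(S N, E N)),
        (⟨fun ξ : S N => sphereDiv X ξ, continuous_sphereDiv hX⟩ : C(S N, ℝ))) ∈ 𝒯 :=
      ⟨X, hX, hXt, fun _ => rfl, fun _ => rfl⟩
    have hmem : r⁻¹ * (∫ ξ : S N, ⟪u (r • (ξ : E N)), sphereDiv X ξ⟫ ∂(surf N))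
        + ∫ ξ : S N, ⟪G (r • (ξ : E N)), X ξ⟫ ∂(surf N) = 0 :=
      (closure_minimal (fun p hp => h1 p hp hr) hcl) (hD hX𝒯)
    simp only [inner_real] at hmem
    have e : ∀ ξ : S N, ⟪r • (G (r • (ξ : E N)) - ⟪G (r • (ξ : E N)), (ξ : E N)⟫ • (ξ : E N)),
        X ξ⟫ = r * ⟪G (r • (ξ : E N)), X ξ⟫ := by
      intro ξ
      have hXt' : ⟪(ξ : E N), X ξ⟫ = 0 := by rw [real_inner_comm]; exact hXt ξ
      rw [inner_smul_left, inner_sub_left, inner_smul_left, hXt']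
      simp
    simp_rw [e]
    rw [integral_const_mul]
    have hr0 := hr.1.ne'
    field_simp at hmem
    linarith

end Slices

/-! ### One-dimensional test functions -/

/-- A locally integrable function with nonnegative integral against all nonnegative test
functions is nonnegative almost everywhere. -/
theorem ae_nonneg_of_forall_test {U : Set ℝ} (hU : IsOpen U) {f : ℝ → ℝ}
    (hf : LocallyIntegrableOn f U)
    (h : ∀ ψ : ℝ → ℝ, ContDiff ℝ ∞ ψ → HasCompactSupport ψ → tsupport ψ ⊆ U → (∀ r, 0 ≤ ψ r) →
      0 ≤ ∫ r, ψ r * f r) :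
    ∀ᵐ r : ℝ, r ∈ U → 0 ≤ f r := by
  rw [ae_iff]
  refine measure_null_of_locally_null _ fun x hx => ?_
  have hxU : x ∈ U := by
    by_contra hc
    exact hx fun hxU => absurd hxU hc
  obtain ⟨ε, hε, hεU⟩ := nhds_basis_closedBall.mem_iff.1 (hU.mem_nhds hxU)
  set g : ℝ → ℝ := (closedBall x ε).indicator f with hg
  have hgi : Integrable g := (integrable_indicator_iff measurableSet_closedBall).2
    (hf.integrableOn_compact_subset hεU (isCompact_closedBall x ε))
  have hconv := ContDiffBump.ae_convolution_tendsto_right_of_locallyIntegrable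
    (φ := fun n => mollifier ℝ n) (K := 2) (μ := (volume : Measure ℝ)) (tendsto_mollifier_rOut ℝ)
    (Eventually.of_forall fun n => by simp [mollifier]; field_simp; exact le_rfl)
    hgi.locallyIntegrable
  have hball : ball x (ε / 2) ∈ 𝓝[{r | ¬(r ∈ U → 0 ≤ f r)}] x :=
    mem_nhdsWithin_of_mem_nhds (ball_mem_nhds x (by positivity))
  refine ⟨_, inter_mem hball self_mem_nhdsWithin, ?_⟩
  rw [← nonpos_iff_eq_zero, ← ae_iff.1 hconv]
  refine measure_mono fun y hy hlim => hy.2 fun _ => ?_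
  have hyε : y ∈ closedBall x ε := (ball_subset_closedBall.trans
    (closedBall_subset_closedBall (by linarith))) hy.1
  have hgy : g y = f y := by simp [hg, hyε]
  rw [← hgy]
  refine ge_of_tendsto hlim ?_
  have hsmall := (tendsto_mollifier_rOut ℝ).eventually (Iic_mem_nhds (half_pos hε))
  filter_upwards [hsmall] with n hn
  rw [convolution_eq_swap]
  set ρ := (mollifier ℝ n).normed (volume : Measure ℝ) with hρ
  have hsub : ∀ t, t ∉ closedBall x ε → ρ (y - t) = 0 := by
    intro t ht
    by_contra h0
    have h1 : y - t ∈ Function.support ρ := h0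
    rw [hρ, (mollifier ℝ n).support_normed_eq] at h1
    simp only [mem_ball, dist_zero_right, Real.norm_eq_abs] at h1
    have h2 : |y - x| < ε / 2 := by simpa [Real.dist_eq] using hy.1
    refine ht ?_
    rw [mem_closedBall, Real.dist_eq]
    have h3 : |t - x| ≤ |t - y| + |y - x| := abs_sub_le _ _ _
    rw [abs_sub_comm t y] at h3
    have hn' : (mollifier ℝ n).rOut ≤ ε / 2 := hn
    linarith
  have hs : tsupport (fun t => ρ (y - t)) ⊆ closedBall x ε :=
    closure_minimal (fun t ht => by
      by_contra hc
      exact ht (hsub t hc)) isClosed_closedBall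
  have hsm : ContDiff ℝ ∞ fun t => ρ (y - t) :=
    ((mollifier ℝ n).contDiff_normed).comp (contDiff_const.sub contDiff_id)
  have key := h (fun t => ρ (y - t)) hsm
    ((isCompact_closedBall x ε).of_isClosed_subset (isClosed_tsupport _) hs) (hs.trans hεU)
    (fun t => (mollifier ℝ n).nonneg_normed _)
  refine key.trans_eq (integral_congr_ae (Eventually.of_forall fun t => ?_))
  by_cases ht : t ∈ closedBall x ε
  · simp [hg, ht]
  · simp [hsub t ht]

/-- The tail integral `∫_r^∞ ψ`. Its derivative is `-ψ`, so testing with tails turns inequalities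
between derivatives into inequalities tested against `ψ`. -/
noncomputable def tail (ψ : ℝ → ℝ) (r : ℝ) : ℝ := ∫ s in Ioi r, ψ s

section Tail

variable {ψ : ℝ → ℝ} {T : ℝ}

theorem tail_eq (hψ : Continuous ψ) (hs : HasCompactSupport ψ) (r : ℝ) :
    tail ψ r = tail ψ 0 - ∫ s in (0 : ℝ)..r, ψ s := by
  have hi : Integrable ψ := hψ.integrable_of_hasCompactSupport hs
  have := intervalIntegral.integral_interval_add_Ioi (a := 0) (b := r)
    hi.integrableOn hi.integrableOn
  rw [tail, tail, ← this]; ring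

theorem hasDerivAt_tail (hψ : Continuous ψ) (hs : HasCompactSupport ψ) (r : ℝ) :
    HasDerivAt (tail ψ) (-ψ r) r := by
  have h := (hψ.integral_hasStrictDerivAt 0 r).hasDerivAt.const_sub (tail ψ 0)
  rwa [← funext (tail_eq hψ hs)] at h

theorem contDiff_tail (hψ : ContDiff ℝ ∞ ψ) (hs : HasCompactSupport ψ) :
    ContDiff ℝ ∞ (tail ψ) := by
  have h := hasDerivAt_tail hψ.continuous hs
  rw [contDiff_infty_iff_deriv]
  refine ⟨fun r => (h r).differentiableAt, ?_⟩
  rw [funext fun r => (h r).deriv]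
  exact hψ.neg

theorem tail_nonneg (h0 : ∀ r, 0 ≤ ψ r) (r : ℝ) : 0 ≤ tail ψ r :=
  integral_nonneg fun _ => h0 _

theorem tail_le (hψ : Continuous ψ) (hs : HasCompactSupport ψ) (h0 : ∀ r, 0 ≤ ψ r) (r : ℝ) :
    tail ψ r ≤ ∫ s, ψ s :=
  setIntegral_le_integral (hψ.integrable_of_hasCompactSupport hs) (Eventually.of_forall h0)

theorem eventually_tail_eq (hψ : Continuous ψ) (hs : HasCompactSupport ψ)
    (hT : tsupport ψ ⊆ Ioo 0 T) : ∀ᶠ r in 𝓝 0, tail ψ r = tail ψ 0 := by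
  have h0 : (0 : ℝ) ∉ tsupport ψ := fun h => lt_irrefl _ (hT h).1
  obtain ⟨ε, hε, hεs⟩ := Metric.mem_nhds_iff.1 ((isClosed_tsupport ψ).isOpen_compl.mem_nhds h0)
  filter_upwards [ball_mem_nhds (0 : ℝ) hε] with r hr
  rw [tail_eq hψ hs, intervalIntegral.integral_zero_ae, sub_zero]
  refine Eventually.of_forall fun s hs' => image_eq_zero_of_notMem_tsupport (hεs ?_)
  rw [mem_ball, dist_zero_right, Real.norm_eq_abs] at hr ⊢
  have h1 := abs_lt.1 hr
  rw [mem_uIoc] at hs'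
  rw [abs_lt]
  constructor <;> rcases hs' with h | h <;> linarith [h.1, h.2]

theorem exists_tail_eq_zero (hs : HasCompactSupport ψ) (hT : tsupport ψ ⊆ Ioo 0 T) (hT0 : 0 < T) :
    ∃ T' < T, ∀ r, T' ≤ r → tail ψ r = 0 := by
  by_cases hne : (tsupport ψ).Nonempty
  · obtain ⟨m, hm, hmax⟩ := hs.isCompact.exists_isGreatest hne
    refine ⟨m, (hT hm).2, fun r hr => setIntegral_eq_zero_of_forall_eq_zero fun s hs' => ?_⟩
    refine image_eq_zero_of_notMem_tsupport fun h => ?_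
    have := hmax h
    have := mem_Ioi.1 hs'
    linarith
  · refine ⟨0, hT0, fun r _ => setIntegral_eq_zero_of_forall_eq_zero fun s _ => ?_⟩
    exact image_eq_zero_of_notMem_tsupport fun h => hne ⟨s, h⟩

end Tail

/-! ### Radial test functions -/

section Radial

variable {N : ℕ} {T : ℝ} {u : E N → ℝ} {G : E N → E N}

theorem contDiff_radial {Ψ : ℝ → ℝ} (hΨ : ContDiff ℝ ∞ Ψ) (h0 : ∀ᶠ r in 𝓝 0, Ψ r = Ψ 0) :
    ContDiff ℝ ∞ fun x : E N => Ψ ‖x‖ := by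
  rw [contDiff_iff_contDiffAt]
  intro x
  by_cases hx : x = 0
  · subst hx
    have h2 : Tendsto (fun x : E N => ‖x‖) (𝓝 0) (𝓝 0) := by
      simpa using (continuous_norm (E := E N)).tendsto 0
    exact (contDiffAt_const (c := Ψ 0)).congr_of_eventuallyEq (h2.eventually h0)
  · exact hΨ.contDiffAt.comp x (contDiffAt_norm ℝ hx)

theorem isTest_radial {Ψ : ℝ → ℝ} (hΨ : ContDiff ℝ ∞ Ψ) (h0 : ∀ᶠ r in 𝓝 0, Ψ r = Ψ 0)
    {T' : ℝ} (hT' : T' < T) (hz : ∀ r, T' ≤ r → Ψ r = 0) :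
    IsTest (ball (0 : E N) T) fun x => Ψ ‖x‖ := by
  have hs : tsupport (fun x : E N => Ψ ‖x‖) ⊆ closedBall 0 T' :=
    closure_minimal (fun x hx => by
      by_contra hc
      refine hx (hz _ ?_)
      simpa using (not_le.1 (by simpa using hc)).le) isClosed_closedBall
  exact ⟨contDiff_radial hΨ h0,
    (isCompact_closedBall _ _).of_isClosed_subset (isClosed_tsupport _) hs,
    hs.trans (closedBall_subset_ball hT')⟩

theorem gradient_radial {Ψ : ℝ → ℝ} (hΨ : ContDiff ℝ ∞ Ψ) {r : ℝ} (hr : 0 < r) (ξ : S N) :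
    gradient (fun x : E N => Ψ ‖x‖) (r • (ξ : E N)) = deriv Ψ r • (ξ : E N) := by
  have hn : ‖r • (ξ : E N)‖ = r := norm_smul_sphere hr ξ
  have hx0 : r • (ξ : E N) ≠ 0 := by rw [← norm_ne_zero_iff, hn]; exact hr.ne'
  have h1 := (hΨ.differentiable (by simp)).differentiableAt.hasDerivAt.comp_hasFDerivAt
    (r • (ξ : E N)) (hasFDerivAt_norm_of_ne_zero hx0)
  refine HasGradientAt.gradient ?_
  rw [hasGradientAt_iff_hasFDerivAt]
  refine h1.congr_fderiv ?_
  ext v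
  simp only [hn, smul_apply, innerSL_apply_apply, InnerProductSpace.toDual_apply_apply,
    inner_smul_left, smul_eq_mul]
  simp only [conj_trivial]
  field_simp

/-- The flux `∫_S u ∂_r u` of `u²/2` through the sphere of radius `r`, with respect to the
surface measure of the unit sphere. -/
noncomputable def flux (u : E N → ℝ) (G : E N → E N) (r : ℝ) : ℝ :=
  ∫ ξ : S N, ⟪u (r • (ξ : E N)) • G (r • (ξ : E N)), (ξ : E N)⟫ ∂(surf N)

theorem IsH1Ball.integrable_smul (hu : IsH1Ball T u G) : Integrable fun x => u x • G x :=
  memLp_one_iff_integrable.1 (hu.memLp_grad.smul hu.memLp)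

theorem IsH1Ball.integrable_norm_sq (hu : IsH1Ball T u G) : Integrable fun x => ‖G x‖ ^ 2 :=
  (memLp_two_iff_integrable_sq_norm hu.memLp_grad.1).1 hu.memLp_grad

/-- The Caccioppoli inequality for radial test functions, in polar coordinates. -/
theorem IsH1Ball.radial_caccioppoli [NeZero N] (hu : IsH1Ball T u G)
    (hsub : WeaklySubharmonic (ball 0 T) G)
    (hu0 : ∀ᵐ x ∂(volume.restrict (ball (0 : E N) T)), 0 ≤ u x) {Ψ : ℝ → ℝ}
    (hΨ : ContDiff ℝ ∞ Ψ) (h0 : ∀ᶠ r in 𝓝 0, Ψ r = Ψ 0) {T' : ℝ} (hT' : T' < T)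
    (hz : ∀ r, T' ≤ r → Ψ r = 0) (hpos : ∀ r, 0 ≤ r → 0 ≤ Ψ r) :
    ∫ r in Ioi 0, r ^ (N - 1) *
      (Ψ r * sphereIntegral (fun x => ‖G x‖ ^ 2) r + deriv Ψ r * flux u G r) ≤ 0 := by
  have ht := isTest_radial (N := N) hΨ h0 hT' hz
  set φ : E N → ℝ := fun x => Ψ ‖x‖ with hφ
  have h1 := hu.isH1.caccioppoli isOpen_ball hsub hu0 ht (fun x => hpos _ (norm_nonneg x))
  rw [setIntegral_eq_integral_of_forall_compl_eq_zero
    (fun x hx => by simp [hu.grad_zero x hx])] at h1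
  have hG2 := hu.integrable_norm_sq
  have huG := hu.integrable_smul
  have i1 : Integrable fun x => ‖G x‖ ^ 2 * φ x := by
    obtain ⟨C, hC⟩ := ht.compact.exists_bound_of_continuous ht.smooth.continuous
    exact hG2.mul_bdd (c := C) ht.smooth.continuous.aestronglyMeasurable (Eventually.of_forall hC)
  have hgc : Continuous fun x => gradient φ x := by
    have := ht.smooth.continuous_fderiv (by simp)
    exact (InnerProductSpace.toDual ℝ (E N)).symm.continuous.comp this
  have hgs : HasCompactSupport fun x => gradient φ x :=
    HasCompactSupport.intro ht.compact fun x hx => by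
      have : fderiv ℝ φ x = 0 :=
        image_eq_zero_of_notMem_tsupport fun h => hx (tsupport_fderiv_subset ℝ h)
      simp [gradient, this]
  have i2 : Integrable fun x => u x * ⟪G x, gradient φ x⟫ := by
    obtain ⟨C, hC⟩ := hgs.exists_bound_of_continuous hgc
    have e : (fun x => u x * ⟪G x, gradient φ x⟫) = fun x => ⟪u x • G x, gradient φ x⟫ := by
      ext x; rw [inner_smul_left]; simp
    rw [e]
    refine Integrable.mono' (huG.norm.mul_const C)
      (huG.1.inner (𝕜 := ℝ) hgc.aestronglyMeasurable) (Eventually.of_forall fun x => ?_)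
    exact (norm_inner_le_norm _ _).trans (mul_le_mul_of_nonneg_left (hC x) (norm_nonneg _))
  rw [integral_eq_integral_sphereIntegral
    (f := fun x => ‖G x‖ ^ 2 * φ x + u x * ⟪G x, gradient φ x⟫) (i1.add i2)] at h1
  refine le_of_eq_of_le (integral_congr_ae ?_) h1
  filter_upwards [ae_restrict_mem measurableSet_Ioi, ae_integrable_slice hG2,
    ae_integrable_slice huG] with r (hr : 0 < r) hGr huGr
  have j2 := integrable_inner_continuous huGr (continuous_subtype_val : Continuous
    fun ξ : S N => (ξ : E N))
  simp only [sphereIntegral, flux]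
  rw [← integral_const_mul (Ψ r), ← integral_const_mul (deriv Ψ r),
    ← integral_add (hGr.const_mul _) (j2.const_mul _)]
  congr 1
  refine integral_congr_ae (Eventually.of_forall fun ξ => ?_)
  simp only [hφ]
  rw [gradient_radial hΨ hr, norm_smul_sphere hr, inner_smul_right, inner_smul_left]
  simp only [conj_trivial]
  ring

theorem sphereDiv_id (ξ : S N) : sphereDiv (fun x => x) ξ = N - 1 := by
  simp [sphereDiv]

/-- `∫_S u²` has weak radial derivative `2 ∫_S u ∂_r u`. -/
theorem IsH1Ball.radial_sq_by_parts [NeZero N] (hu : IsH1Ball T u G) {ψ : ℝ → ℝ}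
    (hψ : ContDiff ℝ ∞ ψ) (hψT : tsupport ψ ⊆ Ioo 0 T) :
    ∫ r in Ioi 0, r ^ (N - 1) *
      (deriv ψ r * sphereIntegral (fun x => u x ^ 2) r
        + ψ r * (r⁻¹ * ((N - 1) * sphereIntegral (fun x => u x ^ 2) r) + 2 * flux u G r)) = 0 := by
  have hu2 : Integrable fun x => u x ^ 2 := hu.memLp.integrable_sq
  have huG : Integrable fun x => (2 * u x) • G x := by
    simpa only [mul_smul, Pi.smul_apply] using! hu.integrable_smul.smul (2 : ℝ)
  have h := integral_polar_by_parts hu2 huG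
    (fun φ hφ v => hu.isH1.sq_by_parts isOpen_ball hφ v) hψ hψT (contDiff_id (E := E N))
  refine Eq.trans (integral_congr_ae (Eventually.of_forall fun r => ?_)) h
  have e1 : ∀ ξ : S N, ⟪id (ξ : E N), (ξ : E N)⟫ = 1 := fun ξ => inner_self_sphere ξ
  have e2 : ∀ ξ : S N, sphereDiv (id : E N → E N) ξ = N - 1 := fun ξ => sphereDiv_id ξ
  simp only [e1, e2, mul_one, integral_mul_const, sphereIntegral, flux]
  rw [← integral_const_mul (2 : ℝ)]
  congr 3
  congr 1
  · ring
  · refine integral_congr_ae (Eventually.of_forall fun ξ => ?_)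
    simp only [inner_smul_left, id]
    simp only [conj_trivial]
    ring

end Radial

/-! ### The energy is controlled by boundary terms -/

/-- A nonnegative weakly subharmonic `H¹` function on the ball of radius `T` around the origin,
extended by zero. -/
structure IsSubharmonicBall {N : ℕ} (T : ℝ) (u : E N → ℝ) (G : E N → E N) : Prop
    extends IsH1Ball T u G where
  subharmonic : WeaklySubharmonic (ball 0 T) G
  nonneg : ∀ᵐ x ∂(volume.restrict (ball (0 : E N) T)), 0 ≤ u x

/-- The integral of `|∇u|²` over the sphere of radius `r`, with respect to the surface measure
of the unit sphere. -/
noncomputable def energy {N : ℕ} (G : E N → E N) (r : ℝ) : ℝ :=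
  sphereIntegral (fun x => ‖G x‖ ^ 2) r

/-- The integral of `u²` over the sphere of radius `r`, with respect to the surface measure
of the unit sphere. -/
noncomputable def mass {N : ℕ} (u : E N → ℝ) (r : ℝ) : ℝ :=
  sphereIntegral (fun x => u x ^ 2) r

/-- The boundary terms obtained by integrating `Δ(u²/2) |x|^(2-N)` over the ball of
radius `r`. -/
noncomputable def boundaryTerm {N : ℕ} (u : E N → ℝ) (G : E N → E N) (r : ℝ) : ℝ :=
  r * flux u G r + ((N : ℝ) - 2) / 2 * mass u r

section OneDim

variable {Φ : ℝ → ℝ} {T : ℝ}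

theorem locallyIntegrableOn_of_pow_mul {g : ℝ → ℝ} {n : ℕ}
    (hg : IntegrableOn (fun r => r ^ n * g r) (Ioi 0)) : LocallyIntegrableOn g (Ioi 0) := by
  have hc : ContinuousOn (fun r : ℝ => (r ^ n)⁻¹) (Ioi 0) :=
    ContinuousOn.inv₀ (by fun_prop) fun r hr => (pow_pos hr n).ne'
  have h := hg.locallyIntegrableOn.continuousOn_mul hc isOpen_Ioi.isLocallyClosed
  rw [locallyIntegrableOn_iff isOpen_Ioi.isLocallyClosed] at h ⊢
  intro k hk hkc
  refine (h k hk hkc).congr_fun (fun r hr => ?_) hkc.measurableSet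
  have : r ^ n ≠ 0 := (pow_pos (hk hr) n).ne'
  field_simp

theorem integrable_mul_of_locallyIntegrableOn {g c : ℝ → ℝ} (hg : LocallyIntegrableOn g (Ioi 0))
    (hc : Continuous c) (hs : HasCompactSupport c) (hT : tsupport c ⊆ Ioo 0 T) :
    Integrable fun r => c r * g r := by
  have h1 : IntegrableOn g (tsupport c) :=
    hg.integrableOn_compact_subset (hT.trans Ioo_subset_Ioi_self) hs
  refine (integrableOn_iff_integrable_of_support_subset fun r hr => ?_).1
    (h1.continuousOn_mul hc.continuousOn hs)
  exact subset_tsupport _ (left_ne_zero_of_mul hr)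

theorem hasDerivAt_inv_pow (n : ℕ) {r : ℝ} (hr : r ≠ 0) :
    HasDerivAt (fun r : ℝ => (r ^ n)⁻¹) (-(n : ℝ) * (r ^ (n + 1))⁻¹) r := by
  have h := hasDerivAt_zpow (-(n : ℤ)) r (Or.inl hr)
  have e : (fun r : ℝ => r ^ (-(n : ℤ))) = fun r => (r ^ n)⁻¹ := by
    ext r; rw [zpow_neg, zpow_natCast]
  have e2 : r ^ (-(n : ℤ) - 1) = (r ^ (n + 1))⁻¹ := by
    rw [show -(n : ℤ) - 1 = -((n + 1 : ℕ) : ℤ) by push_cast; ring, zpow_neg, zpow_natCast]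
  rw [e, e2] at h
  simpa only [Int.cast_neg, Int.cast_natCast] using h

theorem eventually_eq_zero_of_tsupport (hT : tsupport Φ ⊆ Ioo 0 T) : ∀ᶠ r in 𝓝 0, Φ r = 0 := by
  have h0 : (0 : ℝ) ∉ tsupport Φ := fun h => lt_irrefl _ (hT h).1
  filter_upwards [(isClosed_tsupport Φ).isOpen_compl.mem_nhds h0] with r hr
  exact image_eq_zero_of_notMem_tsupport hr

theorem contDiff_mul_inv_pow (hΦ : ContDiff ℝ ∞ Φ) (hT : tsupport Φ ⊆ Ioo 0 T) (n : ℕ) :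
    ContDiff ℝ ∞ fun r => Φ r * (r ^ n)⁻¹ := by
  rw [contDiff_iff_contDiffAt]
  intro r
  by_cases hr : r = 0
  · subst hr
    refine (contDiffAt_const (c := (0 : ℝ))).congr_of_eventuallyEq ?_
    filter_upwards [eventually_eq_zero_of_tsupport hT] with r hr
    simp [hr]
  · exact hΦ.contDiffAt.mul ((contDiffAt_id.pow n).inv (pow_ne_zero n hr))

theorem deriv_mul_inv_pow (hΦ : ContDiff ℝ ∞ Φ) (n : ℕ) {r : ℝ} (hr : r ≠ 0) :
    deriv (fun r => Φ r * (r ^ n)⁻¹) r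
      = deriv Φ r * (r ^ n)⁻¹ + Φ r * (-(n : ℝ) * (r ^ (n + 1))⁻¹) :=
  ((hΦ.differentiable (by simp)).differentiableAt.hasDerivAt.mul (hasDerivAt_inv_pow n hr)).deriv

theorem exists_forall_ge_eq_zero (hs : HasCompactSupport Φ) (hT : tsupport Φ ⊆ Ioo 0 T)
    (hT0 : 0 < T) : ∃ T' < T, ∀ r, T' ≤ r → Φ r = 0 := by
  by_cases hne : (tsupport Φ).Nonempty
  · obtain ⟨m, hm, hmax⟩ := hs.isCompact.exists_isGreatest hne
    have hmT := (hT hm).2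
    refine ⟨(m + T) / 2, by linarith, fun r hr => image_eq_zero_of_notMem_tsupport fun h => ?_⟩
    have := hmax h
    linarith
  · exact ⟨0, hT0, fun r _ => image_eq_zero_of_notMem_tsupport fun h => hne ⟨r, h⟩⟩

end OneDim

section Energy

variable {N : ℕ} {T : ℝ} {u : E N → ℝ} {G : E N → E N}

theorem energy_nonneg (r : ℝ) : 0 ≤ energy G r := integral_nonneg fun _ => by positivity

theorem mass_nonneg (r : ℝ) : 0 ≤ mass u r := integral_nonneg fun _ => by positivity

variable [NeZero N]

theorem IsH1Ball.locallyIntegrableOn_energy (hu : IsH1Ball T u G) :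
    LocallyIntegrableOn (energy G) (Ioi 0) :=
  locallyIntegrableOn_of_pow_mul (integrableOn_sphereIntegral hu.integrable_norm_sq)

theorem IsH1Ball.locallyIntegrableOn_mass (hu : IsH1Ball T u G) :
    LocallyIntegrableOn (mass u) (Ioi 0) :=
  locallyIntegrableOn_of_pow_mul (integrableOn_sphereIntegral hu.memLp.integrable_sq)

theorem IsH1Ball.integrableOn_flux (hu : IsH1Ball T u G) :
    IntegrableOn (fun r => r ^ (N - 1) * flux u G r) (Ioi 0) :=
  integrableOn_integral_inner_continuous hu.integrable_smul continuous_subtype_val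

theorem IsH1Ball.locallyIntegrableOn_flux (hu : IsH1Ball T u G) :
    LocallyIntegrableOn (flux u G) (Ioi 0) :=
  locallyIntegrableOn_of_pow_mul hu.integrableOn_flux

theorem IsH1Ball.locallyIntegrableOn_boundaryTerm (hu : IsH1Ball T u G) :
    LocallyIntegrableOn (boundaryTerm u G) (Ioi 0) :=
  (hu.locallyIntegrableOn_flux.continuousOn_mul continuousOn_id isOpen_Ioi.isLocallyClosed).add
    (hu.locallyIntegrableOn_mass.continuousOn_mul continuousOn_const isOpen_Ioi.isLocallyClosed)

/-- Testing with radial functions that are constant near the origin shows that the flux of `u²/2`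
through spheres is nonnegative. -/
theorem IsSubharmonicBall.flux_nonneg (hu : IsSubharmonicBall T u G) (hT : 0 < T) :
    ∀ᵐ r : ℝ, r ∈ Ioo 0 T → 0 ≤ flux u G r := by
  have h : ∀ᵐ r : ℝ, r ∈ Ioo 0 T → 0 ≤ r ^ (N - 1) * flux u G r := by
    refine ae_nonneg_of_forall_test isOpen_Ioo
      (hu.integrableOn_flux.mono_set Ioo_subset_Ioi_self).locallyIntegrableOn ?_
    intro ψ hψ hs hψT h0
    obtain ⟨T', hT', hz⟩ := exists_tail_eq_zero hs hψT hT
    have h1 := hu.radial_caccioppoli hu.subharmonic hu.nonneg (contDiff_tail hψ hs)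
      (eventually_tail_eq hψ.continuous hs hψT) hT' hz (fun r _ => tail_nonneg h0 r)
    simp only [(hasDerivAt_tail hψ.continuous hs _).deriv] at h1
    have i1 : IntegrableOn (fun r => tail ψ r * (r ^ (N - 1) * energy G r)) (Ioi 0) :=
      (integrableOn_sphereIntegral hu.integrable_norm_sq).bdd_mul (c := ∫ s, ψ s)
        (contDiff_tail hψ hs).continuous.aestronglyMeasurable
        (Eventually.of_forall fun r => by
          rw [Real.norm_eq_abs, abs_of_nonneg (tail_nonneg h0 r)]
          exact tail_le hψ.continuous hs h0 r)
    have i2 : IntegrableOn (fun r => ψ r * (r ^ (N - 1) * flux u G r)) (Ioi 0) := by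
      obtain ⟨C, hC⟩ := hs.exists_bound_of_continuous hψ.continuous
      exact hu.integrableOn_flux.bdd_mul (c := C) hψ.continuous.aestronglyMeasurable
        (Eventually.of_forall hC)
    have e : ∫ r in Ioi 0, (tail ψ r * (r ^ (N - 1) * energy G r)
        - ψ r * (r ^ (N - 1) * flux u G r)) ≤ 0 := by
      refine le_of_eq_of_le (integral_congr_ae (Eventually.of_forall fun r => ?_)) h1
      simp only [energy]; ring
    rw [integral_sub i1 i2] at e
    have e2 : 0 ≤ ∫ r in Ioi 0, tail ψ r * (r ^ (N - 1) * energy G r) :=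
      setIntegral_nonneg measurableSet_Ioi fun r hr =>
        mul_nonneg (tail_nonneg h0 r) (mul_nonneg (pow_nonneg (le_of_lt hr) _) (energy_nonneg r))
    rw [← setIntegral_eq_integral_of_forall_compl_eq_zero (s := Ioi 0)
      (fun r hr => by
        rw [image_eq_zero_of_notMem_tsupport fun h => hr (hψT h).1, zero_mul])]
    linarith
  filter_upwards [h] with r hr hrT
  exact nonneg_of_mul_nonneg_right (hr hrT) (pow_pos hrT.1 _)

/-- Weakly on `(0, T)`, the derivative of the boundary term is at least `r ∫_S |∇u|²`. -/
theorem IsSubharmonicBall.integral_boundaryTerm_le (hu : IsSubharmonicBall T u G) (hT : 0 < T)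
    (hN : 2 ≤ N) {Φ : ℝ → ℝ} (hΦ : ContDiff ℝ ∞ Φ) (hs : HasCompactSupport Φ)
    (hΦT : tsupport Φ ⊆ Ioo 0 T) (h0 : ∀ r, 0 ≤ Φ r) :
    ∫ r in Ioi 0, (Φ r * (r * energy G r) + deriv Φ r * boundaryTerm u G r) ≤ 0 := by
  obtain ⟨n, rfl⟩ : ∃ n, N = n + 2 := ⟨N - 2, by omega⟩
  have hsub : ∀ m : ℕ, tsupport (fun r => Φ r * (r ^ m)⁻¹) ⊆ Ioo 0 T := fun m =>
    tsupport_mul_subset_left.trans hΦT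
  have hev : ∀ᶠ r in 𝓝 0, Φ r * (r ^ n)⁻¹ = Φ 0 * (0 ^ n)⁻¹ := by
    have h := eventually_eq_zero_of_tsupport hΦT
    filter_upwards [h] with r hr
    rw [hr, h.self_of_nhds]; simp
  obtain ⟨T', hT', hz⟩ := exists_forall_ge_eq_zero hs hΦT hT
  -- the Caccioppoli inequality with weight `Φ r ^ (2 - N)`, and the radial derivative of `∫ u²`
  -- tested with `Φ r ^ (1 - N)`, which cancels the Jacobian
  have h1 := hu.radial_caccioppoli hu.subharmonic hu.nonneg (contDiff_mul_inv_pow hΦ hΦT n) hev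
    hT' (fun r hr => by rw [hz r hr, zero_mul])
    (fun r hr => mul_nonneg (h0 r) (inv_nonneg.2 (pow_nonneg hr n)))
  have h2 := hu.radial_sq_by_parts (contDiff_mul_inv_pow hΦ hΦT (n + 1)) (hsub (n + 1))
  have hdc : Continuous (deriv Φ) := hΦ.continuous_deriv (by simp)
  have hds : tsupport (deriv Φ) ⊆ Ioo 0 T := tsupport_deriv_subset.trans hΦT
  have i1 : Integrable fun r => (r * Φ r) * energy G r :=
    integrable_mul_of_locallyIntegrableOn hu.locallyIntegrableOn_energy
      (continuous_id.mul hΦ.continuous) hs.mul_left (tsupport_mul_subset_right.trans hΦT)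
  have i2 : Integrable fun r => (r * deriv Φ r) * flux u G r :=
    integrable_mul_of_locallyIntegrableOn hu.locallyIntegrableOn_flux
      (continuous_id.mul hdc) hs.deriv.mul_left (tsupport_mul_subset_right.trans hds)
  have i3 : Integrable fun r => Φ r * flux u G r :=
    integrable_mul_of_locallyIntegrableOn hu.locallyIntegrableOn_flux hΦ.continuous hs hΦT
  have i4 : Integrable fun r => deriv Φ r * mass u r :=
    integrable_mul_of_locallyIntegrableOn hu.locallyIntegrableOn_mass hdc hs.deriv hds
  have e1 : ∫ r in Ioi 0, ((r * Φ r) * energy G r + (r * deriv Φ r) * flux u G r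
      - n * (Φ r * flux u G r)) ≤ 0 := by
    refine le_of_eq_of_le (setIntegral_congr_fun measurableSet_Ioi fun r hr => ?_) h1
    have hr0 : r ≠ 0 := ne_of_gt hr
    rw [deriv_mul_inv_pow hΦ n hr0, energy, show n + 2 - 1 = n + 1 by omega]
    field_simp
    ring
  have e2 : ∫ r in Ioi 0, (deriv Φ r * mass u r + 2 * (Φ r * flux u G r)) = 0 := by
    refine Eq.trans (setIntegral_congr_fun measurableSet_Ioi fun r hr => ?_) h2
    have hr0 : r ≠ 0 := ne_of_gt hr
    rw [deriv_mul_inv_pow hΦ (n + 1) hr0, mass, show n + 2 - 1 = n + 1 by omega]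
    push_cast
    field_simp
    ring
  have i5 : Integrable fun r => (r * Φ r) * energy G r + (r * deriv Φ r) * flux u G r
      - n * (Φ r * flux u G r) := (i1.add i2).sub (i3.const_mul _)
  have i6 : Integrable fun r => deriv Φ r * mass u r + 2 * (Φ r * flux u G r) :=
    i4.add (i3.const_mul _)
  have e3 : ∫ r in Ioi 0, (Φ r * (r * energy G r) + deriv Φ r * boundaryTerm u G r)
      = (∫ r in Ioi 0, ((r * Φ r) * energy G r + (r * deriv Φ r) * flux u G r
        - n * (Φ r * flux u G r)))
        + (n : ℝ) / 2 * ∫ r in Ioi 0, (deriv Φ r * mass u r + 2 * (Φ r * flux u G r)) := by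
    rw [← integral_const_mul, ← integral_add i5.integrableOn (i6.const_mul _).integrableOn]
    refine integral_congr_ae (Eventually.of_forall fun r => ?_)
    simp only [boundaryTerm]
    push_cast
    ring
  rw [e3, e2]
  linarith

omit [NeZero N] in
theorem IsH1Ball.energy_eq_zero (hu : IsH1Ball T u G) (hT : 0 < T) {r : ℝ} (hr : T ≤ r) :
    energy G r = 0 := by
  have h : ∀ ξ : S N, G (r • (ξ : E N)) = 0 := fun ξ => hu.grad_zero _ (by
    rw [mem_ball_zero_iff, norm_smul_sphere (hT.trans_le hr)]; exact not_lt.2 hr)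
  simp [energy, sphereIntegral, h]

omit [NeZero N] in
theorem IsH1Ball.boundaryTerm_eq_zero (hu : IsH1Ball T u G) (hT : 0 < T) {r : ℝ} (hr : T ≤ r) :
    boundaryTerm u G r = 0 := by
  have h : ∀ ξ : S N, u (r • (ξ : E N)) = 0 := fun ξ => hu.zero _ (by
    rw [mem_ball_zero_iff, norm_smul_sphere (hT.trans_le hr)]; exact not_lt.2 hr)
  simp [boundaryTerm, flux, mass, sphereIntegral, h]

theorem IsSubharmonicBall.boundaryTerm_nonneg (hu : IsSubharmonicBall T u G) (hT : 0 < T)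
    (hN : 2 ≤ N) : ∀ᵐ r : ℝ, 0 < r → 0 ≤ boundaryTerm u G r := by
  filter_upwards [hu.flux_nonneg hT] with r hr hr0
  rcases lt_or_ge r T with hrT | hrT
  · have hN' : (2 : ℝ) ≤ N := by exact_mod_cast hN
    exact add_nonneg (mul_nonneg hr0.le (hr ⟨hr0, hrT⟩))
      (mul_nonneg (by linarith) (mass_nonneg r))
  · rw [hu.boundaryTerm_eq_zero hT hrT]

theorem IsH1Ball.integrableOn_mul_energy (hu : IsH1Ball T u G) (hT : 0 < T) {s : ℝ} (hs : 0 < s) :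
    IntegrableOn (fun r => r * energy G r) (Ioi s) := by
  have h1 : LocallyIntegrableOn (fun r => r * energy G r) (Ioi 0) :=
    hu.locallyIntegrableOn_energy.continuousOn_mul continuousOn_id isOpen_Ioi.isLocallyClosed
  have h2 : IntegrableOn (fun r => r * energy G r) (Icc s T) :=
    h1.integrableOn_compact_subset (fun r hr => hs.trans_le hr.1) isCompact_Icc
  have h3 : IntegrableOn (fun r => r * energy G r) (Ioi T) :=
    (integrableOn_zero).congr_fun (fun r hr => by
      simp [hu.energy_eq_zero hT (le_of_lt hr)]) measurableSet_Ioi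
  refine (h2.union h3).mono_set fun r hr => ?_
  rcases le_or_gt r T with h | h
  · exact Or.inl ⟨le_of_lt hr, h⟩
  · exact Or.inr h

/-- A smooth increasing function that vanishes on `(-∞, s / 2]` and is `1` on `[s, ∞)`. -/
noncomputable def cutoff (s r : ℝ) : ℝ := Real.smoothTransition ((2 * r - s) / s)

theorem contDiff_cutoff (s : ℝ) : ContDiff ℝ ∞ (cutoff s) :=
  Real.smoothTransition.contDiff.comp (by fun_prop)

theorem cutoff_monotone {s : ℝ} (hs : 0 < s) : Monotone (cutoff s) := fun a b h =>
  Real.smoothTransition.monotone (by gcongr)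

theorem cutoff_eq_one {s r : ℝ} (hs : 0 < s) (hr : s ≤ r) : cutoff s r = 1 :=
  Real.smoothTransition.one_of_one_le (by rw [le_div_iff₀ hs]; linarith)

theorem cutoff_eq_zero {s r : ℝ} (hs : 0 < s) (hr : r ≤ s / 2) : cutoff s r = 0 :=
  Real.smoothTransition.zero_of_nonpos (div_nonpos_of_nonpos_of_nonneg (by linarith) hs.le)

/-- The weak inequality for the boundary term, integrated over `(s, r)`. The boundary
contribution at `s` has the right sign and is dropped. -/
theorem IsSubharmonicBall.ae_truncated_le_boundaryTerm (hu : IsSubharmonicBall T u G)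
    (hT : 0 < T) (hN : 2 ≤ N) {s : ℝ} (hs : 0 < s) :
    ∀ᵐ r : ℝ, r ∈ Ioo 0 T →
      ∫ ρ in Iio r, (Ioi s).indicator (fun ρ => ρ * energy G ρ) ρ ≤ boundaryTerm u G r := by
  set p : ℝ → ℝ := (Ioi s).indicator (fun ρ => ρ * energy G ρ) with hp
  have hpi : Integrable p :=
    (integrable_indicator_iff measurableSet_Ioi).2 (hu.integrableOn_mul_energy hT hs)
  have hp0 : ∀ ρ, 0 ≤ p ρ := fun ρ => indicator_nonneg
    (fun ρ hρ => mul_nonneg (hs.trans hρ).le (energy_nonneg ρ)) ρ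
  set A : ℝ → ℝ := fun r => ∫ ρ in Iio r, p ρ with hA
  have hAm : Monotone A := fun a b h =>
    setIntegral_mono_set hpi.integrableOn (Eventually.of_forall hp0)
      (Iio_subset_Iio h).eventuallyLE
  have hFl : LocallyIntegrableOn (boundaryTerm u G) (Ioo 0 T) :=
    hu.locallyIntegrableOn_boundaryTerm.mono_set Ioo_subset_Ioi_self
  have h : ∀ᵐ r : ℝ, r ∈ Ioo 0 T → 0 ≤ boundaryTerm u G r - A r := by
    refine ae_nonneg_of_forall_test isOpen_Ioo
      (hFl.sub (hAm.locallyIntegrable.locallyIntegrableOn _)) ?_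
    intro ψ hψ hψs hψT h0
    have hψc := hψ.continuous
    have iF : Integrable fun r => ψ r * boundaryTerm u G r :=
      integrable_mul_of_locallyIntegrableOn hu.locallyIntegrableOn_boundaryTerm hψc hψs hψT
    have iA : Integrable fun r => ψ r * A r := by
      refine integrable_mul_of_locallyIntegrableOn
        (hAm.locallyIntegrable.locallyIntegrableOn _) hψc hψs hψT
    have hfub : ∫ r, ψ r * A r = ∫ ρ, p ρ * tail ψ ρ := by
      have hI : Integrable (Function.uncurry fun r ρ =>
          {q : ℝ × ℝ | q.2 < q.1}.indicator (fun q => ψ q.1 * p q.2) (r, ρ))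
          ((volume : Measure ℝ).prod volume) :=
        ((hψc.integrable_of_hasCompactSupport hψs).mul_prod hpi).indicator
          (measurableSet_lt measurable_snd measurable_fst)
      have hsw := integral_integral_swap hI
      have e1 : ∀ r, ∫ ρ, {q : ℝ × ℝ | q.2 < q.1}.indicator (fun q => ψ q.1 * p q.2) (r, ρ)
          = ψ r * A r := by
        intro r
        rw [hA, ← integral_const_mul, ← integral_indicator measurableSet_Iio]
        rfl
      have e2 : ∀ ρ, ∫ r, {q : ℝ × ℝ | q.2 < q.1}.indicator (fun q => ψ q.1 * p q.2) (r, ρ)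
          = p ρ * tail ψ ρ := by
        intro ρ
        rw [tail, mul_comm, ← integral_mul_const, ← integral_indicator measurableSet_Ioi]
        rfl
      simp_rw [e1, e2] at hsw
      exact hsw
    have hΨc := contDiff_tail hψ hψs
    -- the test function; `Φ' = -ψ χ + Ψ χ'` for the cut-off `χ` and the tail `Ψ` of `ψ`
    set Φ : ℝ → ℝ := fun r => tail ψ r * cutoff s r with hΦ
    have hΦc : ContDiff ℝ ∞ Φ := hΨc.mul (contDiff_cutoff s)
    obtain ⟨T', hT', hz⟩ := exists_tail_eq_zero hψs hψT hT
    have hΦs : tsupport Φ ⊆ Icc (s / 2) T' :=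
      closure_minimal (fun r hr => by
        constructor
        · by_contra hc
          exact hr (by simp [hΦ, cutoff_eq_zero hs (not_le.1 hc).le])
        · by_contra hc
          exact hr (by simp [hΦ, hz r (not_le.1 hc).le])) isClosed_Icc
    have hΦT : tsupport Φ ⊆ Ioo 0 T :=
      hΦs.trans fun r hr => ⟨by linarith [hr.1], hr.2.trans_lt hT'⟩
    have hΦcs : HasCompactSupport Φ := isCompact_Icc.of_isClosed_subset (isClosed_tsupport _) hΦs
    have hχ0 : ∀ r, 0 ≤ cutoff s r := fun r => Real.smoothTransition.nonneg _
    have hχ1 : ∀ r, cutoff s r ≤ 1 := fun r => Real.smoothTransition.le_one _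
    have key := hu.integral_boundaryTerm_le hT hN hΦc hΦcs hΦT
      (fun r => mul_nonneg (tail_nonneg h0 r) (hχ0 r))
    have hd : ∀ r, deriv Φ r = -ψ r * cutoff s r + tail ψ r * deriv (cutoff s) r := fun r =>
      ((hasDerivAt_tail hψc hψs r).mul
        ((contDiff_cutoff s).differentiable (by simp) r).hasDerivAt).deriv
    have ip : Integrable fun ρ => p ρ * tail ψ ρ :=
      hpi.mul_bdd (c := ∫ s, ψ s) hΨc.continuous.aestronglyMeasurable
        (Eventually.of_forall fun r => by
          rw [Real.norm_eq_abs, abs_of_nonneg (tail_nonneg h0 r)]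
          exact tail_le hψc hψs h0 r)
    have i1 : Integrable fun r => (r * Φ r) * energy G r :=
      integrable_mul_of_locallyIntegrableOn hu.locallyIntegrableOn_energy
        (continuous_id.mul hΦc.continuous) hΦcs.mul_left (tsupport_mul_subset_right.trans hΦT)
    have i2 : Integrable fun r => deriv Φ r * boundaryTerm u G r :=
      integrable_mul_of_locallyIntegrableOn hu.locallyIntegrableOn_boundaryTerm
        (hΦc.continuous_deriv (by simp)) hΦcs.deriv (tsupport_deriv_subset.trans hΦT)
    have i3 : Integrable fun r => Φ r * (r * energy G r) + deriv Φ r * boundaryTerm u G r := by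
      refine (i1.congr (Eventually.of_forall fun r => ?_)).add i2
      simp only; ring
    have hle : ∫ r in Ioi 0, (p r * tail ψ r - ψ r * boundaryTerm u G r) ≤ 0 := by
      refine (integral_mono_ae (ip.sub iF).integrableOn i3.integrableOn ?_).trans key
      filter_upwards [ae_restrict_mem measurableSet_Ioi,
        ae_restrict_of_ae (hu.boundaryTerm_nonneg hT hN)] with r hr hF
      have hF0 := hF hr
      have hχ' : 0 ≤ deriv (cutoff s) r := (cutoff_monotone hs).deriv_nonneg
      have hr0 : 0 < r := hr
      -- all three replacements of `Φ` and `Φ'` by `Ψ 1_{(s, ∞)}` and `-ψ` decrease the integrand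
      have a1 : p r * tail ψ r ≤ Φ r * (r * energy G r) := by
        by_cases hrs : r ∈ Ioi s
        · simp only [hp, indicator_of_mem hrs, hΦ, cutoff_eq_one hs (le_of_lt hrs)]
          exact le_of_eq (by ring)
        · simp only [hp, indicator_of_notMem hrs, zero_mul, hΦ]
          exact mul_nonneg (mul_nonneg (tail_nonneg h0 r) (hχ0 r))
            (mul_nonneg hr0.le (energy_nonneg r))
      have a2 : 0 ≤ (1 - cutoff s r) * (ψ r * boundaryTerm u G r) :=
        mul_nonneg (by linarith [hχ1 r]) (mul_nonneg (h0 r) hF0)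
      have a3 : 0 ≤ tail ψ r * deriv (cutoff s) r * boundaryTerm u G r :=
        mul_nonneg (mul_nonneg (tail_nonneg h0 r) hχ') hF0
      simp only [hd, Pi.sub_apply]
      linarith
    rw [setIntegral_eq_integral_of_forall_compl_eq_zero (fun r hr => by
      have hr0 : r ≤ 0 := not_lt.1 hr
      have h1 : p r = 0 := indicator_of_notMem (fun h => absurd (hs.trans h) hr) _
      have h2 : ψ r = 0 := image_eq_zero_of_notMem_tsupport fun h => hr (hψT h).1
      rw [h1, h2]; ring), integral_sub ip iF, ← hfub] at hle
    simp_rw [mul_sub]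
    rw [integral_sub iF iA]
    linarith
  filter_upwards [h] with r hr hrT
  linarith [hr hrT]

/-- The weighted energy of a ball is finite and is bounded by boundary terms. -/
theorem IsSubharmonicBall.ae_integral_mul_energy_le (hu : IsSubharmonicBall T u G)
    (hT : 0 < T) (hN : 2 ≤ N) :
    ∀ᵐ r : ℝ, r ∈ Ioo 0 T → IntegrableOn (fun ρ => ρ * energy G ρ) (Ioo 0 r) ∧
      ∫ ρ in Ioo 0 r, ρ * energy G ρ ≤ boundaryTerm u G r := by
  set a : ℕ → ℝ := fun n => 1 / ((n : ℝ) + 1) with ha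
  have ha0 : ∀ n, 0 < a n := fun n => by positivity
  have hall : ∀ᵐ r : ℝ, ∀ n : ℕ, r ∈ Ioo 0 T →
      ∫ ρ in Iio r, (Ioi (a n)).indicator (fun ρ => ρ * energy G ρ) ρ ≤ boundaryTerm u G r :=
    ae_all_iff.2 fun n => hu.ae_truncated_le_boundaryTerm hT hN (ha0 n)
  filter_upwards [hall] with r hr hrT
  set μ : Measure ℝ := (volume.restrict (Iio r)).restrict (Ioi 0) with hμ
  have hμ' : μ = volume.restrict (Ioo 0 r) := by
    rw [hμ, Measure.restrict_restrict measurableSet_Ioi, Ioi_inter_Iio]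
  have hcov : AECover μ atTop fun n => Ioi (a n) :=
    aecover_Ioi_of_Ioi tendsto_one_div_add_atTop_nhds_zero_nat
  have hres : ∀ n, μ.restrict (Ioi (a n)) = (volume.restrict (Iio r)).restrict (Ioi (a n)) := by
    intro n
    rw [hμ, Measure.restrict_restrict measurableSet_Ioi,
      inter_eq_left.2 (Ioi_subset_Ioi (ha0 n).le)]
  have hint : ∀ n, IntegrableOn (fun ρ => ρ * energy G ρ) (Ioi (a n)) μ := by
    intro n
    rw [IntegrableOn, hres, Measure.restrict_restrict measurableSet_Ioi]
    exact (hu.integrableOn_mul_energy hT (ha0 n)).mono_set inter_subset_left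
  have hb : ∀ n, ∫ ρ in Ioi (a n), ρ * energy G ρ ∂μ ≤ boundaryTerm u G r := by
    intro n
    rw [hres, ← integral_indicator measurableSet_Ioi]
    exact hr n hrT
  have h0 : ∀ᵐ ρ ∂μ, 0 ≤ ρ * energy G ρ := by
    filter_upwards [ae_restrict_mem measurableSet_Ioi] with ρ hρ
    exact mul_nonneg (le_of_lt hρ) (energy_nonneg ρ)
  have hi : Integrable (fun ρ => ρ * energy G ρ) μ :=
    hcov.integrable_of_integral_bounded_of_nonneg_ae _ hint h0 (Eventually.of_forall hb)
  have hlim := hcov.integral_tendsto_of_countably_generated hi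
  rw [hμ'] at hi hlim
  refine ⟨hi, le_of_tendsto' hlim fun n => ?_⟩
  rw [← hμ']
  exact hb n

end Energy

/-! ### Monotonicity from a differential inequality -/

theorem absolutelyContinuousOnInterval_prod {ι : Type*} (S : Finset ι) {f : ι → ℝ → ℝ} {a b : ℝ}
    (hf : ∀ i ∈ S, AbsolutelyContinuousOnInterval (f i) a b) :
    AbsolutelyContinuousOnInterval (fun r => ∏ i ∈ S, f i r) a b := by
  classical
  induction S using Finset.induction_on with
  | empty =>
    simp only [Finset.prod_empty]
    exact contDiffOn_const.absolutelyContinuousOnInterval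
  | insert i S hi ih =>
    simp only [Finset.prod_insert hi]
    exact (hf i (Finset.mem_insert_self i S)).fun_mul
      (ih fun j hj => hf j (Finset.mem_insert_of_mem hj))

/-- If positive absolutely continuous functions `A_j` with derivatives `p_j` satisfy
`∑ r p_j / A_j ≥ 2 ν`, then `r ^ (-2 ν) ∏ A_j` increases. -/
theorem rpow_mul_prod_le {k : ℕ} {ν s t : ℝ} (hs : 0 < s) (hst : s ≤ t) {A p : Fin k → ℝ → ℝ}
    (hi : ∀ j, IntervalIntegrable (p j) volume s t)
    (hA : ∀ j, ∀ r ∈ Icc s t, A j r = A j s + ∫ x in s..r, p j x)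
    (hpos : ∀ j, ∀ r ∈ Icc s t, 0 < A j r)
    (hode : ∀ᵐ r : ℝ, r ∈ Icc s t → 2 * ν ≤ ∑ j, r * p j r / A j r) :
    1 / s ^ (2 * ν) * ∏ j, A j s ≤ 1 / t ^ (2 * ν) * ∏ j, A j t := by
  set B : Fin k → ℝ → ℝ := fun j r => A j s + ∫ x in s..r, p j x with hB
  have huIcc : uIcc s t = Icc s t := uIcc_of_le hst
  have hBA : ∀ j, ∀ r ∈ Icc s t, B j r = A j r := fun j r hr => (hA j r hr).symm
  have hBac : ∀ j, AbsolutelyContinuousOnInterval (B j) s t := fun j =>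
    (contDiffOn_const.absolutelyContinuousOnInterval).fun_add
      ((hi j).absolutelyContinuousOnInterval_intervalIntegral left_mem_uIcc)
  have hw : ContDiffOn ℝ 1 (fun r : ℝ => r ^ (-(2 * ν))) (uIcc s t) := by
    intro r hr
    rw [huIcc] at hr
    exact (Real.contDiffAt_rpow_const_of_ne (hs.trans_le hr.1).ne').contDiffWithinAt
  set f : ℝ → ℝ := fun r => r ^ (-(2 * ν)) * ∏ j, B j r with hf
  have hfac : AbsolutelyContinuousOnInterval f s t :=
    hw.absolutelyContinuousOnInterval.fun_mul
      (absolutelyContinuousOnInterval_prod _ fun j _ => hBac j)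
  have hder : ∀ᵐ r : ℝ, ∀ j, r ∈ uIcc s t → ∀ c ∈ uIcc s t,
      HasDerivAt (fun x => ∫ y in c..x, p j y) (p j r) r :=
    ae_all_iff.2 fun j => (hi j).ae_hasDerivAt_integral
  have hnn : 0 ≤ ∫ r in s..t, deriv f r := by
    refine intervalIntegral.integral_nonneg_of_ae_restrict hst ?_
    filter_upwards [ae_restrict_mem measurableSet_Icc, ae_restrict_of_ae hder,
      ae_restrict_of_ae hode] with r hr hd ho
    have hr0 : 0 < r := hs.trans_le hr.1
    have hdB : ∀ j ∈ Finset.univ, HasDerivAt (B j) (p j r) r := fun j _ =>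
      (hd j (huIcc ▸ hr) s left_mem_uIcc).const_add (A j s)
    have hdP := HasDerivAt.fun_finsetProd hdB
    have hdw := Real.hasDerivAt_rpow_const (x := r) (p := -(2 * ν)) (Or.inl hr0.ne')
    have hBpos : ∀ j, 0 < B j r := fun j => by rw [hBA j r hr]; exact hpos j r hr
    have hP : 0 < ∏ j, B j r := Finset.prod_pos fun j _ => hBpos j
    have hsum : ∑ i, (∏ j ∈ Finset.univ.erase i, B j r) • p i r
        = (∏ j, B j r) * ∑ j, p j r / B j r := by
      rw [Finset.mul_sum]
      refine Finset.sum_congr rfl fun i _ => ?_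
      rw [← Finset.mul_prod_erase Finset.univ (fun j => B j r) (Finset.mem_univ i), smul_eq_mul]
      have := (hBpos i).ne'
      field_simp
    have hdf : deriv f r = _ := (hdw.mul hdP).deriv
    change 0 ≤ deriv f r
    rw [hdf, hsum]
    have ho' : 2 * ν ≤ r * ∑ j, p j r / B j r := by
      rw [Finset.mul_sum]
      refine (ho hr).trans_eq (Finset.sum_congr rfl fun j _ => ?_)
      rw [hBA j r hr, mul_div_assoc]
    have hrw : r ^ (-(2 * ν)) = r * r ^ (-(2 * ν) - 1) := by
      rw [Real.rpow_sub hr0, Real.rpow_one]; field_simp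
    have hfin : (-(2 * ν) * r ^ (-(2 * ν) - 1)) * (∏ j, B j r)
        + r ^ (-(2 * ν)) * ((∏ j, B j r) * ∑ j, p j r / B j r)
        = r ^ (-(2 * ν) - 1) * (∏ j, B j r) * (r * (∑ j, p j r / B j r) - 2 * ν) := by
      rw [hrw]; ring
    rw [hfin]
    exact mul_nonneg (mul_nonneg (Real.rpow_nonneg hr0.le _) hP.le) (by linarith)
  rw [hfac.integral_deriv_eq_sub] at hnn
  have hval : ∀ r ∈ Icc s t, f r = 1 / r ^ (2 * ν) * ∏ j, A j r := by
    intro r hr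
    simp only [hf]
    rw [Real.rpow_neg (hs.trans_le hr.1).le, one_div]
    congr 1
    exact Finset.prod_congr rfl fun j _ => hBA j r hr
  rw [hval s (left_mem_Icc.2 hst), hval t (right_mem_Icc.2 hst)] at hnn
  linarith

/-- The differential inequality is needed only where all factors are positive: where one of them
vanishes, so does the product. -/
theorem monotoneOn_rpow_mul_prod {k : ℕ} {ν T : ℝ} {A p : Fin k → ℝ → ℝ}
    (hi : ∀ j, ∀ r ∈ Ioo 0 T, IntegrableOn (p j) (Ioo 0 r))
    (hp : ∀ j, ∀ r, 0 < r → 0 ≤ p j r)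
    (hA : ∀ j, ∀ r ∈ Ioo 0 T, A j r = ∫ x in Ioo 0 r, p j x)
    (hode : ∀ᵐ r : ℝ, r ∈ Ioo 0 T → (∀ j, 0 < A j r) → 2 * ν ≤ ∑ j, r * p j r / A j r) :
    MonotoneOn (fun r => 1 / r ^ (2 * ν) * ∏ j, A j r) (Ioo 0 T) := by
  have hA0 : ∀ j, ∀ r ∈ Ioo 0 T, 0 ≤ A j r := fun j r hr => by
    rw [hA j r hr]
    exact setIntegral_nonneg measurableSet_Ioo fun x hx => hp j x hx.1
  intro s hs t ht hst
  by_cases hz : ∃ j, A j s = 0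
  · obtain ⟨j, hj⟩ := hz
    have h1 : ∏ j, A j s = 0 := Finset.prod_eq_zero (Finset.mem_univ j) hj
    simp only [h1, mul_zero]
    exact mul_nonneg (one_div_nonneg.2 (Real.rpow_nonneg ht.1.le _))
      (Finset.prod_nonneg fun j _ => hA0 j t ht)
  · have hz' : ∀ j, 0 < A j s := fun j =>
      lt_of_le_of_ne (hA0 j s hs) fun h => hz ⟨j, h.symm⟩
    have hint : ∀ j, ∀ r ∈ Ioo 0 T, IntervalIntegrable (p j) volume 0 r := fun j r hr =>
      (intervalIntegrable_iff_integrableOn_Ioo_of_le hr.1.le).2 (hi j r hr)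
    have hA' : ∀ j, ∀ r ∈ Ioo 0 T, A j r = ∫ x in (0 : ℝ)..r, p j x := fun j r hr => by
      rw [hA j r hr, intervalIntegral.integral_of_le hr.1.le, integral_Ioc_eq_integral_Ioo]
    have hmem : ∀ r ∈ Icc s t, r ∈ Ioo 0 T := fun r hr =>
      ⟨hs.1.trans_le hr.1, hr.2.trans_lt ht.2⟩
    have hadd : ∀ j, ∀ r ∈ Icc s t, A j r = A j s + ∫ x in s..r, p j x := fun j r hr => by
      rw [hA' j r (hmem r hr), hA' j s hs]
      exact (intervalIntegral.integral_add_adjacent_intervals (hint j s hs)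
        ((hint j s hs).symm.trans (hint j r (hmem r hr)))).symm
    have hpos : ∀ j, ∀ r ∈ Icc s t, 0 < A j r := fun j r hr => by
      rw [hadd j r hr]
      refine add_pos_of_pos_of_nonneg (hz' j) (intervalIntegral.integral_nonneg hr.1 fun x hx => ?_)
      exact hp j x (hs.1.trans_le hx.1)
    refine rpow_mul_prod_le hs.1 hst
      (fun j => (hint j s hs).symm.trans (hint j t ht)) hadd hpos ?_
    filter_upwards [hode] with r hr hrm
    exact hr (hmem r hrm) fun j => hpos j r hrm

/-! ### The eigenvalue inequality on spheres -/

section Sphere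

variable {N : ℕ} {v : S N → ℝ} {g : S N → E N}

theorem gam_sq {t : ℝ} (ht : 0 ≤ t) :
    gam N t ^ 2 + ((N : ℝ) - 2) * gam N t = t := by
  have h := Real.sq_sqrt (show 0 ≤ (((N : ℝ) - 2) / 2) ^ 2 + t by positivity)
  rw [gam]
  linear_combination h

theorem gam_nonneg (hN : 2 ≤ N) {t : ℝ} (ht : 0 ≤ t) : 0 ≤ gam N t := by
  have hN' : (2 : ℝ) ≤ N := by exact_mod_cast hN
  rw [gam, sub_nonneg]
  exact Real.le_sqrt_of_sq_le (by linarith)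

theorem lintegral_enorm_sq {F : Type*} [NormedAddCommGroup F] {μ : Measure (S N)} {f : S N → F}
    (hf : MemLp f 2 μ) : ∫⁻ ξ, ‖f ξ‖ₑ ^ 2 ∂μ = ENNReal.ofReal (∫ ξ, ‖f ξ‖ ^ 2 ∂μ) := by
  rw [ofReal_integral_eq_lintegral_ofReal ((memLp_two_iff_integrable_sq_norm hf.1).1 hf)
    (Eventually.of_forall fun ξ => by positivity)]
  refine lintegral_congr fun ξ => ?_
  rw [ENNReal.ofReal_pow (norm_nonneg _), ofReal_norm]

theorem lintegral_enorm_sq_ne_zero (hv : MemLp v 2 (surf N))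
    (hne : ¬ ∀ᵐ ξ ∂(surf N), v ξ = 0) : ∫⁻ ξ, ‖v ξ‖ₑ ^ 2 ∂(surf N) ≠ 0 := by
  intro h
  rw [lintegral_eq_zero_iff' (hv.1.enorm.pow_const 2)] at h
  refine hne ?_
  filter_upwards [h] with ξ hξ
  simpa using hξ

/-- A nonzero function competes in its own eigenvalue problem. -/
theorem eig_le (hv : IsH1Sphere v g) (hne : ¬ ∀ᵐ ξ ∂(surf N), v ξ = 0) :
    eig v ≤ (∫⁻ ξ, ‖g ξ‖ₑ ^ 2 ∂(surf N)) / (∫⁻ ξ, ‖v ξ‖ₑ ^ 2 ∂(surf N)) := by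
  have h0 : surf N ({ξ | v ξ ≠ 0} ∩ {ξ | v ξ = 0}) = 0 := by
    rw [show {ξ | v ξ ≠ 0} ∩ {ξ | v ξ = 0} = ∅ from by ext; simp]
    simp
  exact iInf₂_le_of_le v g <| iInf₂_le_of_le hv hne <| iInf_le_of_le h0 le_rfl

theorem eig_ne_top (hv : IsH1Sphere v g) (hne : ¬ ∀ᵐ ξ ∂(surf N), v ξ = 0) : eig v ≠ ⊤ := by
  refine ne_top_of_le_ne_top (ENNReal.div_ne_top ?_ ?_) (eig_le hv hne)
  · rw [lintegral_enorm_sq hv.memLp_grad]; exact ENNReal.ofReal_ne_top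
  · exact lintegral_enorm_sq_ne_zero hv.memLp hne

theorem eig_mul_integral_le (hv : IsH1Sphere v g) (hne : ¬ ∀ᵐ ξ ∂(surf N), v ξ = 0) :
    (eig v).toReal * ∫ ξ, v ξ ^ 2 ∂(surf N) ≤ ∫ ξ, ‖g ξ‖ ^ 2 ∂(surf N) := by
  have h := eig_le hv hne
  have hne0 := lintegral_enorm_sq_ne_zero hv.memLp hne
  have h1 : eig v * (∫⁻ ξ, ‖v ξ‖ₑ ^ 2 ∂(surf N)) ≤ ∫⁻ ξ, ‖g ξ‖ₑ ^ 2 ∂(surf N) := by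
    refine (ENNReal.le_div_iff_mul_le (Or.inl hne0) (Or.inl ?_)).1 h
    rw [lintegral_enorm_sq hv.memLp]; exact ENNReal.ofReal_ne_top
  rw [lintegral_enorm_sq hv.memLp, lintegral_enorm_sq hv.memLp_grad] at h1
  have h2 := ENNReal.toReal_mono ENNReal.ofReal_ne_top h1
  rw [ENNReal.toReal_mul, ENNReal.toReal_ofReal (integral_nonneg fun ξ => by positivity),
    ENNReal.toReal_ofReal (integral_nonneg fun ξ => by positivity)] at h2
  simpa using h2

end Sphere

section Slice

variable {N : ℕ} [NeZero N] {T : ℝ} {u : E N → ℝ} {G : E N → E N}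

omit [NeZero N] in
/-- If a slice vanishes, so do the boundary terms. -/
theorem boundaryTerm_eq_zero_of_slice {r : ℝ}
    (h : ∀ᵐ ξ : S N ∂(surf N), u (r • (ξ : E N)) = 0) : boundaryTerm u G r = 0 := by
  have h1 : flux u G r = 0 := integral_eq_zero_of_ae (by
    filter_upwards [h] with ξ hξ; simp [hξ])
  have h2 : mass u r = 0 := integral_eq_zero_of_ae (by
    filter_upwards [h] with ξ hξ; simp [hξ])
  rw [boundaryTerm, h1, h2]; ring

/-- On almost every sphere the energy controls the boundary terms, with constant twice the
characteristic exponent of the slice. -/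
theorem IsH1Ball.ae_gam_mul_boundaryTerm_le (hu : IsH1Ball T u G) :
    ∀ᵐ r : ℝ, r ∈ Ioo 0 T → (¬ ∀ᵐ ξ : S N ∂(surf N), u (r • (ξ : E N)) = 0) →
      eig (fun ξ : S N => u (r • (ξ : E N))) ≠ ⊤ ∧
      2 * gam N (eig fun ξ : S N => u (r • (ξ : E N))).toReal * boundaryTerm u G r
        ≤ r * (r * energy G r) := by
  have m1 := (ae_restrict_iff' measurableSet_Ioi).1 (ae_memLp_slice hu.memLp)
  have m2 := (ae_restrict_iff' measurableSet_Ioi).1 (ae_memLp_slice hu.memLp_grad)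
  filter_upwards [ae_isH1Sphere_slice hu, m1, m2] with r hS m1 m2 hr hne
  specialize hS hr
  specialize m1 hr.1
  specialize m2 hr.1
  refine ⟨eig_ne_top hS hne, ?_⟩
  have hlam := eig_mul_integral_le hS hne
  set l : ℝ := (eig fun ξ : S N => u (r • (ξ : E N))).toReal with hl
  set c := gam N l with hc
  have hc2 : c ^ 2 + ((N : ℝ) - 2) * c = l := gam_sq ENNReal.toReal_nonneg
  set v : S N → ℝ := fun ξ => u (r • (ξ : E N)) with hv
  set w : S N → ℝ := fun ξ => r * ⟪G (r • (ξ : E N)), (ξ : E N)⟫ with hw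
  have hξ : Continuous fun ξ : S N => (ξ : E N) := continuous_subtype_val
  have hw2 : MemLp w 2 (surf N) := by
    have h : MemLp (fun ξ : S N => ⟪G (r • (ξ : E N)), (ξ : E N)⟫) 2 (surf N) := by
      refine m2.of_le (m2.1.inner (𝕜 := ℝ) hξ.aestronglyMeasurable)
        (Eventually.of_forall fun ξ => ?_)
      simpa using norm_inner_le_norm (𝕜 := ℝ) (G (r • (ξ : E N))) (ξ : E N)
    exact h.const_mul r
  have i1 : Integrable (fun ξ => v ξ ^ 2) (surf N) := m1.integrable_sq
  have i2 : Integrable (fun ξ => w ξ ^ 2) (surf N) := hw2.integrable_sq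
  have i3 : Integrable (fun ξ => v ξ * w ξ) (surf N) := m1.integrable_mul (q := 2) hw2
  have i4 := (memLp_two_iff_integrable_sq_norm hS.memLp_grad.1).1 hS.memLp_grad
  have hmass : mass u r = ∫ ξ, v ξ ^ 2 ∂(surf N) := rfl
  have hflux : r * flux u G r = ∫ ξ, v ξ * w ξ ∂(surf N) := by
    rw [flux, ← integral_const_mul]
    refine integral_congr_ae (Eventually.of_forall fun ξ => ?_)
    simp only [hv, hw, inner_smul_left, conj_trivial]
    ring
  -- Pythagoras for the radial and tangential parts of the gradient
  have henergy : r * (r * energy G r) = (∫ ξ : S N, ‖r • (G (r • (ξ : E N))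
      - ⟪G (r • (ξ : E N)), (ξ : E N)⟫ • (ξ : E N))‖ ^ 2 ∂(surf N))
        + ∫ ξ, w ξ ^ 2 ∂(surf N) := by
    rw [energy, sphereIntegral, ← integral_const_mul, ← integral_const_mul, ← integral_add i4 i2]
    refine integral_congr_ae (Eventually.of_forall fun ξ => ?_)
    simp only [hw]
    rw [norm_smul, mul_pow, norm_sub_sq_real, norm_smul, inner_smul_right]
    simp only [Real.norm_eq_abs, sq_abs, norm_eq_of_mem_sphere, mul_one]
    ring
  -- `‖w - γ v‖² ≥ 0` and `γ² + (N - 2) γ = λ` combine to the claim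
  have hsq : 0 ≤ ∫ ξ, (w ξ - c * v ξ) ^ 2 ∂(surf N) := integral_nonneg fun ξ => sq_nonneg _
  have hexp : ∫ ξ, (w ξ - c * v ξ) ^ 2 ∂(surf N) = (∫ ξ, w ξ ^ 2 ∂(surf N))
      - 2 * c * (∫ ξ, v ξ * w ξ ∂(surf N)) + c ^ 2 * ∫ ξ, v ξ ^ 2 ∂(surf N) := by
    rw [← integral_const_mul, ← integral_const_mul, ← integral_sub i2 (i3.const_mul _),
      ← integral_add (f := fun ξ => w ξ ^ 2 - 2 * c * (v ξ * w ξ)) (i2.sub (i3.const_mul _))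
        (i1.const_mul _)]
    refine integral_congr_ae (Eventually.of_forall fun ξ => ?_)
    ring
  rw [hexp] at hsq
  rw [henergy, boundaryTerm, hmass, hflux]
  rw [← hc2] at hlam
  nlinarith [hlam, hsq]

end Slice

/-! ### Segregated functions -/

section Segregation

variable {k N : ℕ}

/-- A segregated family without trivial members competes for the optimal partition value. -/
theorem alpha_toReal_le_sum_gam (hN : 2 ≤ N) {v : Fin k → S N → ℝ}
    (hv : ∀ j, ∃ g : S N → E N, IsH1Sphere (v j) g)
    (hseg : ∀ᵐ ξ ∂(surf N), ∏ j, v j ξ ^ 2 = 0) (htop : ∀ j, eig (v j) ≠ ⊤) :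
    (alpha k N).toReal ≤ ∑ j, gam N (eig (v j)).toReal := by
  have h0 : ∫⁻ ξ, ENNReal.ofReal (∏ j, v j ξ ^ 2) ∂(surf N) = 0 := by
    rw [lintegral_congr_ae (g := fun _ => 0), lintegral_zero]
    filter_upwards [hseg] with ξ hξ
    rw [hξ, ENNReal.ofReal_zero]
  have h1 : alpha k N ≤ ∑ j, gamExt N (eig (v j)) :=
    iInf_le_of_le v <| iInf₂_le_of_le hv h0 le_rfl
  have h2 : ∑ j, gamExt N (eig (v j))
      = ENNReal.ofReal (∑ j, gam N (eig (v j)).toReal) := by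
    rw [ENNReal.ofReal_sum_of_nonneg fun j _ => gam_nonneg hN ENNReal.toReal_nonneg]
    exact Finset.sum_congr rfl fun j _ => if_neg (htop j)
  rw [h2] at h1
  have h3 := ENNReal.toReal_mono ENNReal.ofReal_ne_top h1
  rwa [ENNReal.toReal_ofReal
    (Finset.sum_nonneg fun j _ => gam_nonneg hN ENNReal.toReal_nonneg)] at h3

/-- Monotonicity of the product of weighted energies, on balls around the origin. -/
theorem monotoneOn_of_isSubharmonicBall (hN : 2 ≤ N) {T : ℝ} (hT : 0 < T)
    {u : Fin k → E N → ℝ} {G : Fin k → E N → E N}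
    (hu : ∀ j, IsSubharmonicBall T (u j) (G j)) (hseg : ∀ᵐ x, ∏ j, u j x ^ 2 = 0) :
    (∀ j, ∀ r ∈ Ioo 0 T, IntegrableOn (fun ρ => ρ * energy (G j) ρ) (Ioo 0 r)) ∧
    MonotoneOn (fun r => 1 / r ^ (2 * (alpha k N).toReal) *
      ∏ j, ∫ ρ in Ioo 0 r, ρ * energy (G j) ρ) (Ioo 0 T) := by
  have : NeZero N := ⟨by omega⟩
  have hall : ∀ᵐ r : ℝ, ∀ j, r ∈ Ioo 0 T →
      IntegrableOn (fun ρ => ρ * energy (G j) ρ) (Ioo 0 r) ∧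
      ∫ ρ in Ioo 0 r, ρ * energy (G j) ρ ≤ boundaryTerm (u j) (G j) r :=
    ae_all_iff.2 fun j => (hu j).ae_integral_mul_energy_le hT hN
  have hint : ∀ j, ∀ r ∈ Ioo 0 T, IntegrableOn (fun ρ => ρ * energy (G j) ρ) (Ioo 0 r) := by
    intro j r hr
    -- some larger radius is not exceptional
    have : NeBot (ae (volume.restrict (Ioo r T))) := by
      rw [ae_neBot, Ne, Measure.restrict_eq_zero]
      simp [hr.2]
    have h : ∀ᵐ t ∂(volume.restrict (Ioo r T)), t ∈ Ioo r T := ae_restrict_mem measurableSet_Ioo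
    obtain ⟨t, ht, hrt⟩ := ((ae_restrict_of_ae hall).and h).exists
    exact (ht j ⟨hr.1.trans hrt.1, hrt.2⟩).1.mono_set (Ioo_subset_Ioo_right hrt.1.le)
  refine ⟨hint, monotoneOn_rpow_mul_prod hint
    (fun j r hr => mul_nonneg hr.le (energy_nonneg r)) (fun j r hr => rfl) ?_⟩
  have hsl := (ae_restrict_iff' measurableSet_Ioi).1 (ae_ae_polar hseg)
  have hH1 := ae_all_iff.2 fun j => ae_isH1Sphere_slice (hu j).toIsH1Ball
  have hgam := ae_all_iff.2 fun j => (hu j).toIsH1Ball.ae_gam_mul_boundaryTerm_le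
  filter_upwards [hall, hsl, hH1, hgam] with r hall hsl hH1 hgam hr hpos
  -- positivity of the energy excludes trivial slices
  have hne : ∀ j, ¬ ∀ᵐ ξ : S N ∂(surf N), u j (r • (ξ : E N)) = 0 := fun j h => by
    have h1 := (hall j hr).2
    rw [boundaryTerm_eq_zero_of_slice h] at h1
    exact absurd (hpos j) (not_lt.2 h1)
  have hα := alpha_toReal_le_sum_gam hN
    (v := fun j ξ => u j (r • (ξ : E N))) (fun j => ⟨_, hH1 j hr⟩) (hsl hr.1)
    (fun j => (hgam j hr (hne j)).1)
  rw [← mul_le_mul_iff_right₀ (zero_lt_two (α := ℝ)), Finset.mul_sum] at hα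
  refine hα.trans (Finset.sum_le_sum fun j _ => ?_)
  rw [le_div_iff₀ (hpos j)]
  refine le_trans ?_ (hgam j hr (hne j)).2
  exact mul_le_mul_of_nonneg_left (hall j hr).2
    (mul_nonneg zero_le_two (gam_nonneg hN ENNReal.toReal_nonneg))

end Segregation

/-! ### Finiteness of the optimal partition value -/

section Finite

variable {N : ℕ}

/-- Classically differentiable functions on a ball are weakly differentiable. -/
theorem isH1Ball_of_contDiff {F : E N → ℝ} (hF : ContDiff ℝ ∞ F) (T : ℝ) :
    IsH1Ball T ((ball (0 : E N) T).indicator F) ((ball (0 : E N) T).indicator (gradient F)) where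
  isH1 := by
    have hfin : IsFiniteMeasure (volume.restrict (ball (0 : E N) T)) :=
      ⟨by simpa using measure_ball_lt_top⟩
    have hdF : Continuous (gradient F) :=
      (InnerProductSpace.toDual ℝ (E N)).symm.continuous.comp (hF.continuous_fderiv (by simp))
    have hmem : ∀ {V : Type} [NormedAddCommGroup V] {f : E N → V}, Continuous f →
        MemLp ((ball (0 : E N) T).indicator f) 2 (volume.restrict (ball (0 : E N) T)) := by
      intro V _ f hf
      obtain ⟨C, hC⟩ := (isCompact_closedBall (0 : E N) T).exists_bound_of_continuousOn
        hf.continuousOn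
      have h : AEStronglyMeasurable f (volume.restrict (ball (0 : E N) T)) :=
        hf.aestronglyMeasurable
      rw [memLp_congr_ae (indicator_ae_eq_restrict measurableSet_ball)]
      refine MemLp.of_bound h C ?_
      filter_upwards [ae_restrict_mem measurableSet_ball] with x hx
      exact hC x (ball_subset_closedBall hx)
    refine ⟨hmem hF.continuous, hmem hdF, fun φ hφ v => ?_⟩
    have hcF : Continuous fun x => fderiv ℝ F x v :=
      (hF.continuous_fderiv (by simp)).clm_apply continuous_const
    have h1 : ∫ x in ball (0 : E N) T, (ball (0 : E N) T).indicator F x * fderiv ℝ φ x v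
        = ∫ x, F x * fderiv ℝ φ x v := by
      rw [← integral_indicator measurableSet_ball]
      refine integral_congr_ae (Eventually.of_forall fun x => ?_)
      by_cases hx : x ∈ ball (0 : E N) T
      · simp only [indicator_of_mem hx]
      · simp only [indicator_of_notMem hx, hφ.fderiv_eq_zero hx]; simp
    have h2 : ∫ x in ball (0 : E N) T, φ x * ⟪(ball (0 : E N) T).indicator (gradient F) x, v⟫
        = ∫ x, fderiv ℝ F x v * φ x := by
      rw [← integral_indicator measurableSet_ball]
      refine integral_congr_ae (Eventually.of_forall fun x => ?_)
      by_cases hx : x ∈ ball (0 : E N) T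
      · simp only [indicator_of_mem hx, gradient, InnerProductSpace.toDual_symm_apply, mul_comm]
      · simp only [indicator_of_notMem hx, hφ.eq_zero hx]; simp
    rw [h1, h2]
    refine integral_mul_fderiv_eq_neg_fderiv_mul_of_integrable ?_ ?_ ?_
      (fun x _ => hF.differentiable (by simp) x)
      (fun x _ => hφ.smooth.differentiable (by simp) x)
    · exact (hcF.mul hφ.smooth.continuous).integrable_of_hasCompactSupport
        hφ.compact.mul_left
    · exact (hF.continuous.mul (hφ.continuous_fderiv v)).integrable_of_hasCompactSupport
        (hφ.hasCompactSupport_fderiv v).mul_left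
    · exact (hF.continuous.mul hφ.smooth.continuous).integrable_of_hasCompactSupport
        hφ.compact.mul_left
  zero x hx := indicator_of_notMem hx _
  grad_zero x hx := indicator_of_notMem hx _

theorem not_ae_eq_zero_of_continuous [NeZero N] {f : S N → ℝ} (hf : Continuous f) {ξ : S N}
    (hξ : f ξ ≠ 0) : ¬ ∀ᵐ η ∂(surf N), f η = 0 := by
  intro h
  have : (surf N).IsOpenPosMeasure := by unfold surf; infer_instance
  exact hξ (congrFun ((hf.ae_eq_iff_eq (surf N) continuous_const).1 h) ξ)

/-- Smooth functions on the ambient space, restricted to some sphere, give a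
competitor for the optimal partition value. -/
theorem alpha_ne_top_of_contDiff [NeZero N] {k : ℕ} {F : Fin k → E N → ℝ}
    (hF : ∀ j, ContDiff ℝ ∞ (F j)) (hseg : ∀ x, ∏ j, F j x ^ 2 = 0)
    (hne : ∀ j, ∀ r : ℝ, 0 < r → ∃ ξ : S N, F j (r • (ξ : E N)) ≠ 0) : alpha k N ≠ ⊤ := by
  have hae := ae_all_iff.2 fun j => ae_isH1Sphere_slice (isH1Ball_of_contDiff (hF j) 1)
  have : NeBot (ae (volume.restrict (Ioo (0 : ℝ) 1))) := by
    rw [ae_neBot, Ne, Measure.restrict_eq_zero]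
    simp
  have h : ∀ᵐ t ∂(volume.restrict (Ioo (0 : ℝ) 1)), t ∈ Ioo (0 : ℝ) 1 :=
    ae_restrict_mem measurableSet_Ioo
  -- a radius for which all slices are in `H¹` of the sphere
  obtain ⟨r, hS, hr⟩ := ((ae_restrict_of_ae hae).and h).exists
  have hmem : ∀ ξ : S N, r • (ξ : E N) ∈ ball (0 : E N) 1 := fun ξ => by
    rw [mem_ball_zero_iff, norm_smul, norm_eq_of_mem_sphere, mul_one, Real.norm_of_nonneg hr.1.le]
    exact hr.2
  have hS' : ∀ j, ∃ g : S N → E N, IsH1Sphere (fun ξ => F j (r • (ξ : E N))) g := fun j => by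
    have h := hS j hr
    simp only [indicator_of_mem (hmem _)] at h
    exact ⟨_, h⟩
  have htop : ∀ j, eig (fun ξ : S N => F j (r • (ξ : E N))) ≠ ⊤ := fun j => by
    obtain ⟨g, hg⟩ := hS' j
    obtain ⟨ξ, hξ⟩ := hne j r hr.1
    have hc : Continuous fun ξ : S N => F j (r • (ξ : E N)) :=
      (hF j).continuous.comp (by fun_prop)
    exact eig_ne_top hg (not_ae_eq_zero_of_continuous hc hξ)
  have h0 : ∫⁻ ξ : S N, ENNReal.ofReal (∏ j, F j (r • (ξ : E N)) ^ 2) ∂(surf N) = 0 := by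
    simp [hseg]
  refine ne_top_of_le_ne_top ?_ (iInf_le_of_le (fun j (ξ : S N) => F j (r • (ξ : E N))) <|
    iInf₂_le_of_le hS' h0 le_rfl)
  refine ENNReal.sum_ne_top.2 fun j _ => ?_
  rw [gamExt, if_neg (htop j)]
  exact ENNReal.ofReal_ne_top

/-- Two complementary half-spheres and further copies of the whole sphere form an admissible
overlapping partition. -/
theorem alpha_ne_top {k : ℕ} (hk : 2 ≤ k) (hN : 2 ≤ N) : alpha k N ≠ ⊤ := by
  have : NeZero N := ⟨by omega⟩
  have : NeZero k := ⟨by omega⟩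
  have hk1 : 1 < k := hk
  have hc : ContDiff ℝ ∞ fun x : E N => x 0 := by fun_prop
  have hst : ContDiff ℝ ∞ Real.smoothTransition := Real.smoothTransition.contDiff
  let F : Fin k → E N → ℝ := fun j x =>
    if j = ⟨0, by omega⟩ then Real.smoothTransition (x 0)
    else if j = ⟨1, hk1⟩ then Real.smoothTransition (-x 0) else 1
  refine alpha_ne_top_of_contDiff (F := F) (fun j => ?_) (fun x => ?_) (fun j r hr => ?_)
  · simp only [F]
    split_ifs
    · exact hst.comp hc
    · exact hst.comp hc.neg
    · exact contDiff_const
  · rcases le_total (x 0) 0 with h | h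
    · refine Finset.prod_eq_zero (Finset.mem_univ ⟨0, by omega⟩) ?_
      simp [F, Real.smoothTransition.zero_of_nonpos h]
    · refine Finset.prod_eq_zero (Finset.mem_univ ⟨1, hk1⟩) ?_
      simp [F, Real.smoothTransition.zero_of_nonpos (neg_nonpos.2 h)]
  · have hpole : ∀ s : ℝ, |s| = 1 → EuclideanSpace.single (0 : Fin N) s ∈ sphere (0 : E N) 1 :=
      fun s hs => by simpa using hs
    simp only [F]
    split_ifs
    · refine ⟨⟨_, hpole 1 (by simp)⟩, (Real.smoothTransition.pos_of_pos ?_).ne'⟩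
      simpa using hr
    · refine ⟨⟨_, hpole (-1) (by simp)⟩, (Real.smoothTransition.pos_of_pos ?_).ne'⟩
      simpa using hr
    · exact ⟨⟨_, hpole 1 (by simp)⟩, one_ne_zero⟩

end Finite

/-! ### Localization and translation -/

section Localize

variable {N : ℕ} {U V : Set (E N)} {u : E N → ℝ} {G : E N → E N}

theorem IsTest.gradient_eq_zero {φ : E N → ℝ} (hφ : IsTest U φ) {x : E N} (hx : x ∉ U) :
    gradient φ x = 0 := by
  rw [gradient, hφ.fderiv_eq_zero hx, map_zero]

theorem IsH1.mono (hu : IsH1 U u G) (hVU : V ⊆ U) (hU : MeasurableSet U) : IsH1 V u G where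
  memLp := hu.memLp.mono_measure (Measure.restrict_mono hVU le_rfl)
  memLp_grad := hu.memLp_grad.mono_measure (Measure.restrict_mono hVU le_rfl)
  by_parts φ hφ v := by
    rw [← setIntegral_eq_of_subset_of_forall_sdiff_eq_zero hU hVU fun x hx => ?_,
      ← setIntegral_eq_of_subset_of_forall_sdiff_eq_zero hU hVU fun x hx => ?_]
    · exact hu.by_parts φ ⟨hφ.smooth, hφ.compact, hφ.supp.trans hVU⟩ v
    · rw [hφ.eq_zero hx.2, zero_mul]
    · rw [hφ.fderiv_eq_zero hx.2, _root_.zero_apply, mul_zero]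

theorem WeaklySubharmonic.mono (h : WeaklySubharmonic U G) (hVU : V ⊆ U)
    (hU : MeasurableSet U) : WeaklySubharmonic V G := by
  intro φ hφ h0
  rw [← setIntegral_eq_of_subset_of_forall_sdiff_eq_zero hU hVU fun x hx => ?_]
  · exact h φ ⟨hφ.smooth, hφ.compact, hφ.supp.trans hVU⟩ h0
  · rw [hφ.gradient_eq_zero hx.2, inner_zero_right]

theorem measurePreserving_add_restrict (x₀ : E N) (hU : MeasurableSet U) :
    MeasurePreserving (fun y => x₀ + y) (volume.restrict ((fun y => x₀ + y) ⁻¹' U))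
      (volume.restrict U) :=
  (measurePreserving_add_left volume x₀).restrict_preimage hU

theorem setIntegral_add_left (x₀ : E N) (U : Set (E N)) (f : E N → ℝ) :
    ∫ y in (fun y => x₀ + y) ⁻¹' U, f (x₀ + y) = ∫ x in U, f x :=
  (measurePreserving_add_left volume x₀).setIntegral_preimage_emb
    (measurableEmbedding_addLeft x₀) f U

theorem IsTest.comp_sub {φ : E N → ℝ} {x₀ : E N} (hφ : IsTest ((fun y => x₀ + y) ⁻¹' U) φ) :
    IsTest U fun x => φ (x - x₀) where
  smooth := hφ.smooth.comp (contDiff_id.sub contDiff_const)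
  compact := hφ.compact.comp_homeomorph (Homeomorph.subRight x₀)
  supp := by
    have h := tsupport_comp_eq_preimage φ (Homeomorph.subRight x₀)
    intro x hx
    have hx' : x - x₀ ∈ tsupport φ := by
      have h1 : x ∈ tsupport (φ ∘ Homeomorph.subRight x₀) := hx
      rw [h] at h1
      exact h1
    simpa using hφ.supp hx'

theorem IsH1.translate (hu : IsH1 U u G) (hU : MeasurableSet U) (x₀ : E N) :
    IsH1 ((fun y => x₀ + y) ⁻¹' U) (fun y => u (x₀ + y)) (fun y => G (x₀ + y)) where
  memLp := hu.memLp.comp_measurePreserving (measurePreserving_add_restrict x₀ hU)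
  memLp_grad := hu.memLp_grad.comp_measurePreserving (measurePreserving_add_restrict x₀ hU)
  by_parts φ hφ v := by
    have h := hu.by_parts _ hφ.comp_sub v
    rw [← setIntegral_add_left x₀ U, ← setIntegral_add_left x₀ U] at h
    simpa only [fderiv_comp_sub, add_sub_cancel_left] using h

theorem WeaklySubharmonic.translate (h : WeaklySubharmonic U G) (x₀ : E N) :
    WeaklySubharmonic ((fun y => x₀ + y) ⁻¹' U) (fun y => G (x₀ + y)) := by
  intro φ hφ h0
  have h1 := h _ hφ.comp_sub fun x => h0 _
  rw [← setIntegral_add_left x₀] at h1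
  simpa only [gradient, fderiv_comp_sub, add_sub_cancel_left] using h1

theorem IsSubharmonicBall.of_indicator {T : ℝ} (hu : IsH1 (ball 0 T) u G)
    (hsub : WeaklySubharmonic (ball 0 T) G)
    (h0 : ∀ᵐ x ∂(volume.restrict (ball (0 : E N) T)), 0 ≤ u x) :
    IsSubharmonicBall T ((ball (0 : E N) T).indicator u) ((ball (0 : E N) T).indicator G) where
  isH1 := by
    refine ⟨?_, ?_, fun φ hφ v => ?_⟩
    · rw [memLp_congr_ae (indicator_ae_eq_restrict measurableSet_ball)]
      exact hu.memLp
    · rw [memLp_congr_ae (indicator_ae_eq_restrict measurableSet_ball)]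
      exact hu.memLp_grad
    · have h1 := setIntegral_congr_fun (μ := volume)
        (f := fun x => (ball (0 : E N) T).indicator u x * fderiv ℝ φ x v)
        (g := fun x => u x * fderiv ℝ φ x v) (measurableSet_ball (x := (0 : E N)) (ε := T))
        fun x hx => by simp only [indicator_of_mem hx]
      have h2 := setIntegral_congr_fun (μ := volume)
        (f := fun x => φ x * ⟪(ball (0 : E N) T).indicator G x, v⟫)
        (g := fun x => φ x * ⟪G x, v⟫) (measurableSet_ball (x := (0 : E N)) (ε := T))
        fun x hx => by simp only [indicator_of_mem hx]
      rw [h1, h2]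
      exact hu.by_parts φ hφ v
  zero x hx := indicator_of_notMem hx _
  grad_zero x hx := indicator_of_notMem hx _
  subharmonic φ hφ hφ0 := by
    rw [setIntegral_congr_fun (g := fun x => ⟪G x, gradient φ x⟫) measurableSet_ball fun x hx => by
      simp only [indicator_of_mem hx]]
    exact hsub φ hφ hφ0
  nonneg := by
    filter_upwards [h0, ae_restrict_mem measurableSet_ball] with x hx hxm
    rwa [indicator_of_mem hxm]

/-- A weakly subharmonic function on a large ball is one on each smaller ball; the smaller ball
is moved to the origin. -/
theorem isSubharmonicBall_translate {R : ℝ} (hu : IsH1 (ball 0 R) u G)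
    (hsub : WeaklySubharmonic (ball 0 R) G)
    (h0 : ∀ᵐ x ∂(volume.restrict (ball (0 : E N) R)), 0 ≤ u x) (x₀ : E N) :
    IsSubharmonicBall (R - ‖x₀‖)
      ((ball (0 : E N) (R - ‖x₀‖)).indicator fun y => u (x₀ + y))
      ((ball (0 : E N) (R - ‖x₀‖)).indicator fun y => G (x₀ + y)) := by
  have hsubset : ball x₀ (R - ‖x₀‖) ⊆ ball 0 R := ball_subset_ball' (by simp)
  have hpre : (fun y => x₀ + y) ⁻¹' ball x₀ (R - ‖x₀‖) = ball (0 : E N) (R - ‖x₀‖) := by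
    rw [preimage_add_ball, sub_self]
  have h1 := (hu.mono hsubset measurableSet_ball).translate measurableSet_ball x₀
  have h2 := (hsub.mono hsubset measurableSet_ball).translate x₀
  have h3 := (measurePreserving_add_restrict x₀
    (measurableSet_ball (x := x₀) (ε := R - ‖x₀‖))).quasiMeasurePreserving.ae
    (ae_mono (Measure.restrict_mono hsubset le_rfl) h0)
  rw [hpre] at h1 h2 h3
  exact IsSubharmonicBall.of_indicator h1 h2 h3

end Localize

/-! ### The weighted energy in polar coordinates -/

section Weighted

variable {N : ℕ} {T r : ℝ} {u : E N → ℝ} {G : E N → E N}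

theorem sphereIntegral_dens_ball (hN : 2 ≤ N) {ρ : ℝ} (hρ : 0 < ρ) :
    ρ ^ (N - 1) * sphereIntegral ((ball (0 : E N) r).indicator (dens G 0)) ρ
      = (Ioo 0 r).indicator (fun ρ => ρ * energy G ρ) ρ := by
  have hmem : ∀ ξ : S N, ρ • (ξ : E N) ∈ ball (0 : E N) r ↔ ρ < r := fun ξ => by
    rw [mem_ball_zero_iff, norm_smul, norm_eq_of_mem_sphere, mul_one, Real.norm_of_nonneg hρ.le]
  by_cases h : ρ < r
  · rw [indicator_of_mem (show ρ ∈ Ioo 0 r from ⟨hρ, h⟩), energy, sphereIntegral, sphereIntegral,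
      ← integral_const_mul, ← integral_const_mul]
    refine integral_congr_ae (Eventually.of_forall fun ξ => ?_)
    simp only [indicator_of_mem ((hmem ξ).2 h), dens, sub_zero]
    rw [norm_smul, norm_eq_of_mem_sphere, mul_one, Real.norm_of_nonneg hρ.le,
      show N - 1 = N - 2 + 1 by omega, pow_succ]
    have := (pow_pos hρ (N - 2)).ne'
    field_simp
  · rw [indicator_of_notMem fun h' : ρ ∈ Ioo 0 r => h h'.2, sphereIntegral]
    simp only [indicator_of_notMem fun h' => h ((hmem _).1 h'), integral_zero, mul_zero]

theorem dens_nonneg (G : E N → E N) (x₀ x : E N) : 0 ≤ dens G x₀ x := by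
  unfold dens; positivity

/-- The weighted density is nonnegative, so that finiteness of its iterated integral in polar
coordinates makes it integrable. -/
theorem integrable_indicator_dens (hN : 2 ≤ N) (hG : MemLp G 2)
    (hint : IntegrableOn (fun ρ => ρ * energy G ρ) (Ioo 0 r)) :
    Integrable ((ball (0 : E N) r).indicator (dens G 0)) := by
  have : NeZero N := ⟨by omega⟩
  have hm : AEStronglyMeasurable ((ball (0 : E N) r).indicator (dens G 0)) volume := by
    refine AEStronglyMeasurable.indicator ?_ measurableSet_ball
    have h1 : AEMeasurable (fun x => ‖G x‖ ^ 2) volume := (hG.1.norm.pow 2).aemeasurable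
    have h2 : Measurable fun x : E N => ‖x - 0‖ ^ (N - 2) := by fun_prop
    exact (h1.div h2.aemeasurable).aestronglyMeasurable
  have hm' := hm.comp_quasiMeasurePreserving
    (measurePreserving_polar (N := N)).quasiMeasurePreserving
  rw [← measurePreserving_polar.integrable_comp hm, integrable_prod_iff hm']
  have hnorm : ∀ x, ‖(ball (0 : E N) r).indicator (dens G 0) x‖
      = (ball (0 : E N) r).indicator (dens G 0) x := fun x =>
    Real.norm_of_nonneg (indicator_nonneg (fun x _ => dens_nonneg G 0 x) x)
  refine ⟨ae_radialMeasure_iff.2 ?_, integrable_radialMeasure_iff.2 ?_⟩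
  · filter_upwards [ae_memLp_slice hG, ae_restrict_mem measurableSet_Ioi,
      ae_radialMeasure_iff.1 hm'.prodMk_left] with ρ h hρ hms
    have h2 := ((memLp_two_iff_integrable_sq_norm h.1).1 h).div_const (ρ ^ (N - 2))
    refine h2.mono' hms (Eventually.of_forall fun ξ => ?_)
    simp only [Function.comp_apply, hnorm]
    refine (indicator_le_self' (fun _ _ => dens_nonneg G 0 _) _).trans_eq ?_
    rw [dens, sub_zero, norm_smul, norm_eq_of_mem_sphere, mul_one,
      Real.norm_of_nonneg (le_of_lt hρ)]
  · have h1 : IntegrableOn ((Ioo 0 r).indicator fun ρ => ρ * energy G ρ) (Ioi 0) :=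
      (hint.integrable_indicator measurableSet_Ioo).integrableOn
    refine h1.congr_fun (fun ρ hρ => ?_) measurableSet_Ioi
    simp only [Function.comp_apply, hnorm]
    exact (sphereIntegral_dens_ball hN hρ).symm

theorem integral_dens_ball (hN : 2 ≤ N) (hG : MemLp G 2)
    (hint : IntegrableOn (fun ρ => ρ * energy G ρ) (Ioo 0 r)) :
    ∫ x in ball (0 : E N) r, dens G 0 x = ∫ ρ in Ioo 0 r, ρ * energy G ρ := by
  have : NeZero N := ⟨by omega⟩
  rw [← integral_indicator measurableSet_ball,
    integral_eq_integral_sphereIntegral (integrable_indicator_dens hN hG hint),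
    setIntegral_congr_fun measurableSet_Ioi fun ρ hρ => sphereIntegral_dens_ball hN hρ,
    setIntegral_indicator measurableSet_Ioo]
  congr 2
  exact inter_eq_right.2 Ioo_subset_Ioi_self

theorem dens_translate_eqOn {x₀ : E N} (hrT : r ≤ T) :
    EqOn (dens ((ball (0 : E N) T).indicator fun y => G (x₀ + y)) 0)
      (fun y => dens G x₀ (x₀ + y)) (ball 0 r) := fun y hy => by
  simp only [dens, indicator_of_mem (ball_subset_ball hrT hy), sub_zero, add_sub_cancel_left]

theorem preimage_add_left_ball (x₀ : E N) (r : ℝ) :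
    (fun y => x₀ + y) ⁻¹' ball x₀ r = ball (0 : E N) r := by
  rw [preimage_add_ball, sub_self]

theorem integrableOn_dens (hN : 2 ≤ N) {x₀ : E N} (hrT : r ≤ T)
    (hG : MemLp ((ball (0 : E N) T).indicator fun y => G (x₀ + y)) 2)
    (hint : IntegrableOn (fun ρ =>
      ρ * energy ((ball (0 : E N) T).indicator fun y => G (x₀ + y)) ρ) (Ioo 0 r)) :
    IntegrableOn (dens G x₀) (ball x₀ r) := by
  have h := (integrable_indicator_iff measurableSet_ball).1 (integrable_indicator_dens hN hG hint)
  rw [← (measurePreserving_add_left volume x₀).integrableOn_comp_preimage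
    (measurableEmbedding_addLeft x₀), preimage_add_left_ball]
  exact h.congr_fun (dens_translate_eqOn hrT) measurableSet_ball

theorem I_eq_integral_energy (hN : 2 ≤ N) {x₀ : E N} (hrT : r ≤ T)
    (hG : MemLp ((ball (0 : E N) T).indicator fun y => G (x₀ + y)) 2)
    (hint : IntegrableOn (fun ρ =>
      ρ * energy ((ball (0 : E N) T).indicator fun y => G (x₀ + y)) ρ) (Ioo 0 r)) :
    I G x₀ r = ∫ ρ in Ioo 0 r,
      ρ * energy ((ball (0 : E N) T).indicator fun y => G (x₀ + y)) ρ := by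
  rw [← integral_dens_ball hN hG hint, I, ← setIntegral_add_left x₀, preimage_add_left_ball]
  exact (setIntegral_congr_fun measurableSet_ball (dens_translate_eqOn hrT)).symm

end Weighted

theorem ae_prod_sq_eq_zero {k N : ℕ} {R : ℝ} {u : Fin k → E N → ℝ}
    (hk : 0 < k) (hm : ∀ j, AEStronglyMeasurable (u j) (volume.restrict (ball (0 : E N) R)))
    (hseg : ∫⁻ x in ball (0 : E N) R, ENNReal.ofReal (∏ j, u j x ^ 2) = 0) (x₀ : E N) :
    ∀ᵐ y, ∏ j, (ball (0 : E N) (R - ‖x₀‖)).indicator (fun y => u j (x₀ + y)) y ^ 2 = 0 := by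
  have hm' : AEMeasurable (fun x => ENNReal.ofReal (∏ j, u j x ^ 2))
      (volume.restrict (ball (0 : E N) R)) :=
    (Finset.aemeasurable_fun_prod _ fun j _ => (hm j).aemeasurable.pow_const 2).ennreal_ofReal
  rw [lintegral_eq_zero_iff' hm', EventuallyEq, ae_restrict_iff' measurableSet_ball] at hseg
  filter_upwards [(measurePreserving_add_left volume x₀).quasiMeasurePreserving.ae hseg] with y hy
  by_cases h : y ∈ ball (0 : E N) (R - ‖x₀‖)
  · simp only [indicator_of_mem h]
    have hmem : x₀ + y ∈ ball (0 : E N) R := by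
      rw [mem_ball_zero_iff] at h ⊢
      linarith [norm_add_le x₀ y]
    exact le_antisymm (ENNReal.ofReal_eq_zero.1 (hy hmem))
      (Finset.prod_nonneg fun j _ => sq_nonneg _)
  · refine Finset.prod_eq_zero (Finset.mem_univ (⟨0, hk⟩ : Fin k)) ?_
    rw [indicator_of_notMem h]
    simp

end ACF

theorem mainTheorem3 (k N : ℕ) (hk : 2 ≤ k) (hN : 2 ≤ N) (R : ℝ)
    (u : Fin k → ACF.E N → ℝ) (G : Fin k → ACF.E N → ACF.E N)
    (hH1 : ∀ j, ACF.IsH1 (ball (0 : ACF.E N) R) (u j) (G j))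
    (hsub : ∀ j, ACF.WeaklySubharmonic (ball (0 : ACF.E N) R) (G j))
    (hnonneg : ∀ j, ∀ᵐ x ∂(volume.restrict (ball (0 : ACF.E N) R)), 0 ≤ u j x)
    (hseg : ∫⁻ x in ball (0 : ACF.E N) R, ENNReal.ofReal (∏ j, u j x ^ 2) = 0)
    (x₀ : ACF.E N) (hx₀ : x₀ ∈ ball (0 : ACF.E N) R) :
    ACF.alpha k N ≠ ⊤ ∧
    (∀ j, ∀ r ∈ Set.Ioo 0 (R - ‖x₀‖), IntegrableOn (ACF.dens (G j) x₀) (ball x₀ r)) ∧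
    MonotoneOn (fun r => ACF.J (ACF.alpha k N).toReal G x₀ r) (Set.Ioo 0 (R - ‖x₀‖)) := by
  have hT : 0 < R - ‖x₀‖ := sub_pos.2 (by simpa using hx₀)
  have hball := fun j => ACF.isSubharmonicBall_translate (hH1 j) (hsub j) (hnonneg j) x₀
  obtain ⟨hint, hmono⟩ := ACF.monotoneOn_of_isSubharmonicBall hN hT hball
    (ACF.ae_prod_sq_eq_zero (by omega) (fun j => (hH1 j).memLp.1) hseg x₀)
  refine ⟨ACF.alpha_ne_top hk hN, fun j r hr => ACF.integrableOn_dens hN hr.2.le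
    (hball j).memLp_grad (hint j r hr), hmono.congr fun r hr => ?_⟩
  simp only [ACF.J]
  congr 1
  exact Finset.prod_congr rfl fun j _ =>
    (ACF.I_eq_integral_energy hN hr.2.le (hball j).memLp_grad (hint j r hr)).symm
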